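/- Let $G=(V,E)$ be a finite simple graph with edge couplings $\kappa_e\ge 0$, let $\beta\ge 0$, and consider Ising spins $\tau\in\{\pm1\}^V$ and angles $\theta\in(-\pi,\pi]^V$ with the Hamiltonian $$H(\tau,\theta)=-\sum_{e=ij\in E}\kappa_e\,(1+\tau_i\tau_j)\cos(\theta_i-\theta_j).$$ Let $\langle\cdot\rangle_{G,\beta}$ be the thermal average, i.e. the expectation under the probability distribution proportional to $e^{-\beta H(\tau,\theta)}$ with respect to counting measure in $\tau$ and Lebesgue measure in $\theta$. For $n:E\to\mathbb N$, let the trace $\hat n$ be the graph on $V$ with edge set $\{e: n_e>0\}$, let $C(\hat n)$ be the number of its connected components (isolated vertices included), let $\delta_i n=\sum_{e\ni i}n_e$, and write $(\beta\kappa)^n=\prod_e(\beta\kappa_e)^{n_e}$, $n!=\prod_e n_e!$. Then for all vertices $0,R\in V$: (i) $\langle\cos 2(\theta_0-\theta_R)\rangle_{G,\beta}\le\langle\tau_0\tau_R\rangle_{G,\beta}$. (ii) Let $\mathbf n$ range over the directed currents, i.e. the functions from the directed edges of $G$ to $\mathbb N$; put $\mathbf n!=\prod_{\vec e}\mathbf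 n_{\vec e}!$ and $n_{ij}=\mathbf n_{i\to j}+\mathbf n_{j\to i}$. The weights $$2^{C(\hat n)}\,\frac{(\beta\kappa)^{n}}{\mathbf n!}\,1\Big\{\textstyle\sum_{j\sim i}(\mathbf n_{i\to j}-\mathbf n_{j\to i})=0\text{ for all } i\in V\Big\}$$ are non-negative with a finite positive sum, and under the probability distribution $\mathbb P$ proportional to them $$\langle\tau_0\tau_R\rangle_{G,\beta}=\mathbb P[\,0\text{ and }R\text{ are connected in }\hat n\,].$$ (iii) A cycle decomposition $\mathcal C$ of $n:E\to\mathbb N$ is a partition of the multigraph in which every edge $e$ is replaced by $n_e$ labelled copies into directed closed loops: each copy gets a direction, and a permutation of the copies sends each copy to a successor that starts where it ends; the loops are the cycles of the permutation. The weights $$2^{C(\hat n)}\,\frac{(\beta\kappa)^{n}}{n!}\prod_{i\in V}\frac1{(\delta_i n/2)!}$$ on all cycle decompositions $\mathcal C$ of all $n:E\to\mathbb N$ are non-negative with a finite positive sum, and under the probability distribution $\mathbb P'$ proportional to them $$\langle\cos 2(\theta_0-\theta_R)\rangle_{G,\beta}\le\mathbb P'[\,0=R,\text{ or some loop of }\mathcal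 C\text{ passes through both }0\text{ and }R\,].$$ -/

import Mathlib

open MeasureTheory

namespace XYIsing

noncomputable section

variable {V : Type*} [Fintype V] [DecidableEq V] (G : SimpleGraph V) [DecidableRel G.Adj]

/-! ### The model -/

/-- The edge observable `(1 + τ_i τ_j) cos (θ_i - θ_j)` of an edge `e = ij`,
for Ising spins `τ` and angles `θ` of the XY spins. -/
def coupling (τ : V → ℤˣ) (θ : V → ℝ) (e : Sym2 V) : ℝ :=
  Sym2.lift ⟨fun i j => (1 + ((τ i : ℤ) : ℝ) * ((τ j : ℤ) : ℝ)) * Real.cos (θ i - θ j),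
    fun i j => by
      dsimp only
      rw [mul_comm ((τ i : ℤ) : ℝ), ← Real.cos_neg, neg_sub]⟩ e

/-- The critical Hamiltonian `H = - ∑_{e = ij} κ_e (1 + τ_i τ_j) cos (θ_i - θ_j)`. -/
def energy (κ : G.edgeSet → ℝ) (τ : V → ℤˣ) (θ : V → ℝ) : ℝ :=
  -∑ e : G.edgeSet, κ e * coupling τ θ e

/-- Lebesgue measure on the angles `θ ∈ (-π, π]^V`. -/
def angleMeasure (V : Type*) [Fintype V] : Measure (V → ℝ) :=
  Measure.pi fun _ : V => volume.restrict (Set.Ioc (-Real.pi) Real.pi)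

/-- The partition function at inverse temperature `β`. -/
def partitionFunction (κ : G.edgeSet → ℝ) (β : ℝ) : ℝ :=
  ∑ τ : V → ℤˣ, ∫ θ, Real.exp (-β * energy G κ τ θ) ∂(angleMeasure V)

/-- The thermal average of an observable `f (τ, θ)` at inverse temperature `β`. -/
def thermalAverage (κ : G.edgeSet → ℝ) (β : ℝ) (f : (V → ℤˣ) → (V → ℝ) → ℝ) : ℝ :=
  (∑ τ : V → ℤˣ, ∫ θ, f τ θ * Real.exp (-β * energy G κ τ θ) ∂(angleMeasure V)) /
    partitionFunction G κ β

/-! ### Probabilities given by weights -/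

/-- The weights `w` can be normalized to a probability distribution. -/
def IsNormalizable {α : Type*} (w : α → ℝ) : Prop :=
  (∀ a, 0 ≤ w a) ∧ Summable w ∧ 0 < ∑' a, w a

/-- The probability of the event `A` under the distribution proportional to `w`. -/
def prob {α : Type*} (w : α → ℝ) (A : Set α) : ℝ :=
  (∑' a, A.indicator w a) / ∑' a, w a

/-! ### Currents -/

variable {G}

/-- The trace of an undirected current `n`: the spanning subgraph of the edges with `n e > 0`. -/
def trace (n : G.edgeSet → ℕ) : SimpleGraph V :=
  SimpleGraph.fromEdgeSet {e | ∃ h : e ∈ G.edgeSet, 0 < n ⟨e, h⟩}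

/-- The number of clusters of the trace, isolated vertices included. -/
def clusterCount (n : G.edgeSet → ℕ) : ℕ := Nat.card (trace n).ConnectedComponent

/-- The undirected current induced by a directed current. -/
def undirected (d : G.Dart → ℕ) (e : G.edgeSet) : ℕ :=
  ∑ a : G.Dart, if a.edge = e then d a else 0

/-- The flow of a directed current out of a vertex. -/
def flow (d : G.Dart → ℕ) (i : V) : ℤ :=
  (∑ a : G.Dart, if a.fst = i then (d a : ℤ) else 0) -
    ∑ a : G.Dart, if a.snd = i then (d a : ℤ) else 0

/-- The weight `2 ^ C(n̂) * (β κ) ^ n / 𝐧! * 1{δ𝐧 = 0}` of a directed current `𝐧` which induces the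
undirected current `n`. -/
def currentWeight (κ : G.edgeSet → ℝ) (β : ℝ) (d : G.Dart → ℕ) : ℝ :=
  {d : G.Dart → ℕ | ∀ i, flow d i = 0}.indicator
    (fun d => 2 ^ clusterCount (undirected d) *
      (∏ e : G.edgeSet, (β * κ e) ^ undirected d e) / ∏ a : G.Dart, ((d a).factorial : ℝ)) d

/-- The event that `x` and `y` are connected in the trace of the undirected current. -/
def tracePercolation (x y : V) : Set (G.Dart → ℕ) :=
  {d | (trace (undirected d)).Reachable x y}

/-! ### Cycle decompositions -/

/-- The edge copies of the multigraph in which the edge `e` is repeated `n e` times. -/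
abbrev EdgeCopy (n : G.edgeSet → ℕ) : Type _ := Σ e : G.edgeSet, Fin (n e)

/-- A partition of the edge copies of `n` into directed closed loops: every edge copy gets a
direction, and a permutation sends every edge copy to its successor, which starts where the
edge copy ends. The loops are the cycles of the permutation. -/
structure CycleDecomposition (n : G.edgeSet → ℕ) where
  dir : EdgeCopy n → G.Dart
  dir_edge : ∀ c, (dir c).edge = c.1
  next : Equiv.Perm (EdgeCopy n)
  next_fst : ∀ c, (dir (next c)).fst = (dir c).snd

/-- The degree of a vertex in the undirected current `n`. -/
def currentDegree (n : G.edgeSet → ℕ) (i : V) : ℕ :=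
  ∑ e : G.edgeSet, if i ∈ (e : Sym2 V) then n e else 0

/-- The weight `2 ^ C(n̂) * (β κ) ^ n / n! * 1 / λ_n`, with `λ_n = ∏_i (δ_i n / 2)!`, of a cycle
decomposition of the undirected current `n`. All `δ_i n` are even if `n` has a
cycle decomposition. -/
def cycleWeight (κ : G.edgeSet → ℝ) (β : ℝ)
    (C : Σ n : G.edgeSet → ℕ, CycleDecomposition n) : ℝ :=
  2 ^ clusterCount C.1 * (∏ e : G.edgeSet, (β * κ e) ^ C.1 e) /
    (∏ e : G.edgeSet, ((C.1 e).factorial : ℝ)) /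
    ∏ i : V, ((currentDegree C.1 i / 2).factorial : ℝ)

/-- The event that some loop of the cycle decomposition passes through both `x` and `y`
(a vertex is always connected to itself). -/
def cyclePercolation (x y : V) : Set (Σ n : G.edgeSet → ℕ, CycleDecomposition n) :=
  {C | x = y ∨ ∃ a b : EdgeCopy C.1, C.2.next.SameCycle a b ∧
    x ∈ (a.1 : Sym2 V) ∧ y ∈ (b.1 : Sym2 V)}

end

end XYIsing

namespace XYIsing

section Combinatorics

open scoped Classical Nat

/-! ### Counting equivalences over a base -/

theorem exists_equiv_over {α β ι : Type*} [Finite α] [Finite β] (f : α → ι) (g : β → ι)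
    (h : ∀ i, Nat.card {x // f x = i} = Nat.card {y // g y = i}) :
    ∃ e : α ≃ β, ∀ x, g (e x) = f x := by
  let e' : ∀ i, {x // f x = i} ≃ {y // g y = i} := fun i => Classical.choice (Finite.card_eq.1 (h i))
  refine ⟨(Equiv.sigmaFiberEquiv f).symm.trans
    ((Equiv.sigmaCongrRight e').trans (Equiv.sigmaFiberEquiv g)), fun x => ?_⟩
  exact (e' (f x) ⟨x, rfl⟩).2

/-- Composition with one fixed bijection over the base turns these bijections into the permutations
preserving all fibres of `f`, a product of symmetric groups. -/
theorem card_equiv_over {α β ι : Type*} [Fintype α] [Finite β] [Fintype ι]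
    (f : α → ι) (g : β → ι)
    (h : ∀ i, Nat.card {x // f x = i} = Nat.card {y // g y = i}) :
    Nat.card {e : α ≃ β // ∀ x, g (e x) = f x} = ∏ i, (Nat.card {x // f x = i})! := by
  obtain ⟨e₀, h₀⟩ := exists_equiv_over f g h
  have h₁ : ∀ y, f (e₀.symm y) = g y := fun y => by rw [← h₀, e₀.apply_symm_apply]
  have key : {e : α ≃ β // ∀ x, g (e x) = f x} ≃ {π : Equiv.Perm α // f ∘ π = f} :=
    { toFun := fun e => ⟨e.1.trans e₀.symm, by
        funext x; simp [h₁, e.2]⟩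
      invFun := fun π => ⟨π.1.trans e₀, fun x => by
        have := congrFun π.2 x
        simpa [h₀] using this⟩
      left_inv := fun e => by ext x; simp
      right_inv := fun e => by ext x; simp }
  rw [Nat.card_congr key, Nat.card_eq_fintype_card, DomMulAct.stabilizer_card]
  simp [Nat.card_eq_fintype_card]

/-! ### Sums with random signs -/

/-- The sign of a Boolean. -/
def sgn (b : Bool) : ℤ := if b then 1 else -1

/-- The number of choices of signs which give the sum `m`. -/
noncomputable def signCount {Ω : Type*} [Fintype Ω] (t : Ω → ℤ) (m : ℤ) : ℕ :=
  Nat.card {ε : Ω → Bool // ∑ K, sgn (ε K) * t K = m}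

theorem signCount_congr {Ω Ω' : Type*} [Fintype Ω] [Fintype Ω'] (e : Ω ≃ Ω') (t : Ω' → ℤ) (m : ℤ) :
    signCount (t ∘ e) m = signCount t m := by
  refine Nat.card_congr ((Equiv.arrowCongr e (Equiv.refl Bool)).subtypeEquiv fun ε => ?_)
  rw [← Equiv.sum_comp e]
  simp

theorem signCount_option {Ω : Type*} [Fintype Ω] (t : Option Ω → ℤ) (m : ℤ) :
    signCount t m = signCount (fun K => t (some K)) (m - t none) +
      signCount (fun K => t (some K)) (m + t none) := by
  rw [signCount, signCount, signCount, ← Nat.card_sum]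
  refine Nat.card_congr ?_
  exact
    { toFun := fun ε => if h : ε.1 none = true
        then Sum.inl ⟨fun K => ε.1 (some K), by
          have := ε.2
          rw [Fintype.sum_option, h] at this
          simp only [sgn, if_true] at this ⊢
          linarith⟩
        else Sum.inr ⟨fun K => ε.1 (some K), by
          have := ε.2
          rw [Fintype.sum_option] at this
          simp only [sgn, h] at this ⊢
          simp only [Bool.false_eq_true, if_false] at this
          linarith⟩
      invFun := fun s => s.elim
        (fun ε => ⟨fun o => o.elim true ε.1, by
          rw [Fintype.sum_option]
          change sgn true * t none + ∑ i, sgn (ε.1 i) * t (some i) = m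
          rw [ε.2]
          simp [sgn]⟩)
        (fun ε => ⟨fun o => o.elim false ε.1, by
          rw [Fintype.sum_option]
          change sgn false * t none + ∑ i, sgn (ε.1 i) * t (some i) = m
          rw [ε.2]
          simp [sgn]⟩)
      left_inv := fun ε => by
        by_cases h : ε.1 none = true
        · simp only [h, dif_pos, Sum.elim_inl]
          ext o
          cases o <;> simp [h]
        · simp only [h]
          ext o
          cases o <;> simp [h]
      right_inv := fun s => by
        rcases s with ε | ε <;> simp }

/-- Induction on the number of terms: the sign of one term `s` splits the count at `m` into the
counts at `m - s` and `m + s`. This unimodality is what compares sources of strength 2 with balanced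
orientations. -/
theorem signCount_le {Ω : Type*} [Fintype Ω] (t : Ω → ℤ) (ht : ∀ K, |t K| ≤ 1) :
    ∀ m m' : ℤ, |m| ≤ |m'| → 2 ∣ m' - m → signCount t m' ≤ signCount t m := by
  revert t
  refine Fintype.induction_empty_option (P := fun Ω _ => ∀ t : Ω → ℤ, (∀ K, |t K| ≤ 1) →
    ∀ m m' : ℤ, |m| ≤ |m'| → 2 ∣ m' - m → signCount t m' ≤ signCount t m) ?_ ?_ ?_ Ω
  · intro α β _ e ih t ht m m' h h2
    let := Fintype.ofEquiv β e.symm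
    rw [← signCount_congr e, ← signCount_congr e]
    convert! ih (t ∘ e) (fun K => ht _) m m' h h2
  · intro t _ m m' h h2
    by_cases hm : m' = 0
    · subst hm
      have : m = 0 := by simpa using h
      rw [this]
    · have : IsEmpty {ε : PEmpty → Bool // ∑ K, sgn (ε K) * t K = m'} :=
        ⟨fun ε => hm (by simpa using ε.2.symm)⟩
      rw [signCount, Nat.card_of_isEmpty]
      exact Nat.zero_le _
  · intro α _ ih t ht m m' h h2
    rw [signCount_option, signCount_option]
    have ih' := ih (fun K => t (some K)) (fun K => ht _)
    have h0 := ht none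
    set s := t none
    by_cases hm : m = m'
    · rw [hm]
    -- Here the two summands are matched crosswise, since `m - s = -(m' + s)`.
    by_cases hm' : m = -m'
    · rw [add_comm]
      refine add_le_add (ih' _ _ ?_ ?_) (ih' _ _ ?_ ?_)
      · rw [hm', ← abs_neg]; apply le_of_eq; congr 1; ring
      · omega
      · rw [hm', ← abs_neg]; apply le_of_eq; congr 1; ring
      · omega
    -- Now parity gives `|m| ≤ |m'| - 2`, so `|m ± s| ≤ |m'| - 1 ≤ |m' ± s|`.
    rcases (by rw [abs_le] at h0; omega : s = 0 ∨ s = 1 ∨ s = -1) with hs | hs | hs <;> rw [hs] <;>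
    refine add_le_add (ih' _ _ ?_ ?_) (ih' _ _ ?_ ?_) <;> grind

/-! ### Orientations of multigraphs

The edges of the multigraph are the elements of `X`, and `vert (x, c)` for `c : Bool` are the ends
of `x`. An orientation `σ` lets `x` start at `vert (x, σ x)`. -/

variable {V X : Type*} [Fintype X] (vert : X × Bool → V)

/-- The start of the oriented edge `x`. -/
def tail (σ : X → Bool) (x : X) : V := vert (x, σ x)

/-- The end of the oriented edge `x`. -/
def head (σ : X → Bool) (x : X) : V := vert (x, !σ x)

/-- The out-degree minus the in-degree. -/
noncomputable def excess (σ : X → Bool) (v : V) : ℤ :=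
  ∑ x, ((if tail vert σ x = v then 1 else 0) - if head vert σ x = v then 1 else 0)

/-- The number of ends of edges at a vertex. -/
noncomputable def endCount (v : V) : ℕ := Nat.card {h : X × Bool // vert h = v}

/-- The sign of a half-edge: `1` if it is outgoing and `-1` if it is incoming. -/
def endSign (σ : X → Bool) (h : X × Bool) : ℤ := if h.2 = σ h.1 then 1 else -1

/-- The other half-edge of the same edge. -/
def opp (h : X × Bool) : X × Bool := (h.1, !h.2)

theorem opp_opp {X : Type*} (h : X × Bool) : opp (opp h) = h := by simp [opp]

theorem endSign_opp {X : Type*} (σ : X → Bool) (h : X × Bool) :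
    endSign σ (opp h) = -endSign σ h := by
  rcases h with ⟨x, c⟩
  cases c <;> cases hs : σ x <;> simp [opp, endSign, hs]

theorem endSign_eq {X : Type*} (σ : X → Bool) (h : X × Bool) :
    endSign σ h = 1 ∨ endSign σ h = -1 := by
  unfold endSign; split_ifs <;> simp

theorem excess_eq_sum_endSign (σ : X → Bool) (v : V) :
    excess vert σ v = ∑ h : X × Bool, if vert h = v then endSign σ h else 0 := by
  rw [Fintype.sum_prod_type, excess]
  refine Finset.sum_congr rfl fun x _ => ?_
  cases hs : σ x <;> simp [tail, head, endSign, hs] <;> split_ifs <;> simp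

theorem sum_excess [Fintype V] (σ : X → Bool) : ∑ v, excess vert σ v = 0 := by
  unfold excess
  rw [Finset.sum_comm]
  refine Finset.sum_eq_zero fun x _ => ?_
  rw [Finset.sum_sub_distrib]
  simp

theorem card_tail_add_card_head (σ : X → Bool) (v : V) :
    Nat.card {x // tail vert σ x = v} + Nat.card {x // head vert σ x = v} = endCount vert v := by
  rw [endCount, ← Nat.card_sum]
  refine Nat.card_congr ?_
  exact
    { toFun := fun s => s.elim (fun x => ⟨(x.1, σ x.1), x.2⟩) (fun x => ⟨(x.1, !σ x.1), x.2⟩)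
      invFun := fun h => if hh : h.1.2 = σ h.1.1
        then Sum.inl ⟨h.1.1, by rw [tail, ← hh]; exact h.2⟩
        else Sum.inr ⟨h.1.1, by
          have : (!σ h.1.1) = h.1.2 := by
            cases h1 : h.1.2 <;> cases h2 : σ h.1.1 <;> simp_all
          rw [head, this]; exact h.2⟩
      left_inv := fun s => by rcases s with x | x <;> simp
      right_inv := fun h => by
        obtain ⟨⟨x, c⟩, h⟩ := h
        by_cases hh : c = σ x
        · simp [hh]
        · have : (!σ x) = c := by
            cases h1 : c <;> cases h2 : σ x <;> simp_all
          simp [hh, this] }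

theorem excess_eq_card_sub_card (σ : X → Bool) (v : V) :
    excess vert σ v =
      (Nat.card {x // tail vert σ x = v} : ℤ) - Nat.card {x // head vert σ x = v} := by
  rw [excess, Finset.sum_sub_distrib, Nat.card_eq_fintype_card, Nat.card_eq_fintype_card,
    Fintype.card_subtype, Fintype.card_subtype]
  simp

theorem card_tail_eq_card_head {σ : X → Bool} {v : V} (h : excess vert σ v = 0) :
    Nat.card {x // tail vert σ x = v} = Nat.card {x // head vert σ x = v} := by
  have := excess_eq_card_sub_card vert σ v
  omega

theorem card_head_eq {σ : X → Bool} {v : V} (h : excess vert σ v = 0) :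
    Nat.card {x // head vert σ x = v} = endCount vert v / 2 := by
  have h1 := card_tail_eq_card_head vert h
  have h2 := card_tail_add_card_head vert σ v
  omega

/-- A successor permutation exists only for balanced orientations. -/
theorem excess_eq_zero_of_perm {σ : X → Bool} (π : Equiv.Perm X)
    (h : ∀ x, tail vert σ (π x) = head vert σ x) (v : V) : excess vert σ v = 0 := by
  rw [excess, Finset.sum_sub_distrib, sub_eq_zero, ← Equiv.sum_comp π]
  simp [h]

/-- A successor permutation is a choice, at every vertex, of a bijection from the incoming to the
outgoing edges; balance makes both numbers half of the degree. -/
theorem card_successor [Fintype V] {σ : X → Bool} (h : ∀ v, excess vert σ v = 0) :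
    Nat.card {π : Equiv.Perm X // ∀ x, tail vert σ (π x) = head vert σ x} =
      ∏ v, (endCount vert v / 2)! := by
  rw [card_equiv_over (head vert σ) (tail vert σ)
    fun v => (card_tail_eq_card_head vert (h v)).symm]
  exact Finset.prod_congr rfl fun v _ => by rw [card_head_eq vert (h v)]

/-! ### Pairings of the half-edges -/

/-- A pairing of the half-edges at every vertex outside of `B`. -/
structure IsPairing (B : Set V) (p : X × Bool → X × Bool) : Prop where
  invol : ∀ h, p (p h) = h
  vert_eq : ∀ h, vert (p h) = vert h
  fixed : ∀ h, vert h ∈ B → p h = h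

/-- The orientation pairs incoming with outgoing half-edges. -/
def Compat (B : Set V) (p : X × Bool → X × Bool) (σ : X → Bool) : Prop :=
  ∀ h, vert h ∉ B → endSign σ (p h) = -endSign σ h

/-- The relation of edges on the same strand of a pairing. -/
def strand {X : Type*} (p : X × Bool → X × Bool) : Setoid X :=
  Relation.EqvGen.setoid fun x y => ∃ c, (p (x, c)).1 = y

theorem strand_pairing {X : Type*} (p : X × Bool → X × Bool) (h : X × Bool) :
    (strand p) h.1 (p h).1 := Relation.EqvGen.rel _ _ ⟨h.2, rfl⟩

variable {vert} {B : Set V} {p : X × Bool → X × Bool}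

/-- A strand with a half-edge in `B` has exactly two of them, of opposite orientations. -/
theorem IsPairing.exists_other_end (hp : IsPairing vert B p) (h₀ : X × Bool) (h₀B : vert h₀ ∈ B) :
    ∃ h₁, vert h₁ ∈ B ∧ strand p h₀.1 h₁.1 ∧
      (∀ h, vert h ∈ B → strand p h₀.1 h.1 → h = h₀ ∨ h = h₁) ∧
      ∀ σ, Compat vert B p σ → endSign σ h₁ = -endSign σ h₀ := by
  -- Walk along the strand: pass to the partner of a half-edge, then cross the partner's edge. From
  -- `h₀`, which `p` fixes, the first step only crosses its own edge.
  set ρ : X × Bool → X × Bool := fun h => opp (p h) with hρ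
  have hinj : Function.Injective ρ := fun h h' e => by
    have := congrArg (fun z => p (opp z)) e
    simpa [hρ, opp_opp, hp.invol] using this
  set f : ℕ → X × Bool := fun j => ρ^[j] h₀ with hf
  have f0 : f 0 = h₀ := rfl
  have fs : ∀ j, f (j + 1) = opp (p (f j)) := fun j => Function.iterate_succ_apply' ρ j h₀
  have pf : ∀ j, p (f j) = opp (f (j + 1)) := fun j => by rw [fs, opp_opp]
  have pof : ∀ j, p (opp (f (j + 1))) = f j := fun j => by rw [← pf, hp.invol]
  have hex : ∃ k, 1 ≤ k ∧ vert (f k) ∈ B := by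
    -- An injective map of a finite set returns to `h₀`, so the walk meets `B` again; `k` is the
    -- first time at which it does.
    obtain ⟨m, hm, hm'⟩ := hinj.mem_periodicPts h₀
    refine ⟨m, hm, ?_⟩
    have : f m = h₀ := hm'
    rwa [this]
  set k := Nat.find hex
  obtain ⟨hk1, hkB⟩ := Nat.find_spec hex
  have hlt : ∀ j, 1 ≤ j → j < k → vert (f j) ∉ B := fun j h1 h2 h3 => Nat.find_min hex h2 ⟨h1, h3⟩
  have f1 : (f 1).1 = h₀.1 := by rw [fs, f0, hp.fixed _ h₀B]; rfl
  have hst : ∀ j, strand p h₀.1 (f j).1 := by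
    intro j
    induction j with
    | zero => exact (strand p).refl _
    | succ j ih =>
      refine (strand p).trans ih ?_
      rw [fs]
      exact strand_pairing p _
  -- The edges visited up to time `k` are closed under the pairing, hence they form the whole
  -- strand.
  set S : Set X := {x | ∃ j, 1 ≤ j ∧ j ≤ k ∧ (f j).1 = x} with hS
  have hclosed : ∀ h : X × Bool, h.1 ∈ S → (p h).1 ∈ S := by
    rintro h ⟨j, hj1, hjk, hj⟩
    have hcase : h = f j ∨ h = opp (f j) := by
      rcases h with ⟨x, c⟩
      rcases hfj' : f j with ⟨y, d⟩
      rw [hfj'] at hj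
      simp only at hj
      subst hj
      cases c <;> cases d <;> simp [opp]
    rcases hcase with rfl | rfl
    · rcases hjk.lt_or_eq with hlt' | rfl
      · refine ⟨j + 1, by omega, by omega, ?_⟩
        rw [pf]; rfl
      · rw [hp.fixed _ hkB]
        exact ⟨_, hj1, le_rfl, rfl⟩
    · obtain ⟨i, rfl⟩ : ∃ i, j = i + 1 := ⟨j - 1, by omega⟩
      rw [pof]
      rcases Nat.eq_zero_or_pos i with rfl | hi
      · exact ⟨1, le_rfl, hk1, by rw [f1, f0]⟩
      · exact ⟨i, hi, by omega, rfl⟩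
  have hstS : ∀ x y, strand p x y → (x ∈ S ↔ y ∈ S) := by
    intro x y hxy
    induction hxy with
    | rel x y h =>
      obtain ⟨c, rfl⟩ := h
      refine ⟨fun hx => hclosed (x, c) hx, fun hy => ?_⟩
      have := hclosed (p (x, c)) hy
      rwa [hp.invol] at this
    | refl x => rfl
    | symm x y _ ih => exact ih.symm
    | trans x y z _ _ ih1 ih2 => exact ih1.trans ih2
  have h0S : h₀.1 ∈ S := ⟨1, le_rfl, hk1, f1⟩
  refine ⟨f k, hkB, hst k, ?_, ?_⟩
  · intro h hB hh
    obtain ⟨j, hj1, hjk, hj⟩ := (hstS _ _ hh).1 h0S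
    have hcase : h = f j ∨ h = opp (f j) := by
      rcases h with ⟨x, c⟩
      rcases hfj' : f j with ⟨y, d⟩
      rw [hfj'] at hj
      simp only at hj
      subst hj
      cases c <;> cases d <;> simp [opp]
    rcases hcase with rfl | rfl
    · right
      by_contra hne
      have hjk' : j ≠ k := fun e => hne (by rw [e])
      exact hlt j hj1 (by omega) hB
    · left
      obtain ⟨i, rfl⟩ : ∃ i, j = i + 1 := ⟨j - 1, by omega⟩
      rcases Nat.eq_zero_or_pos i with rfl | hi
      · have := pof 0
        rw [hp.fixed _ hB] at this
        exact this
      · exfalso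
        have h1 := hp.vert_eq (opp (f (i + 1)))
        rw [pof] at h1
        exact hlt i hi (by omega) (by rwa [h1])
  · intro σ hσ
    -- The first crossing reverses the sign; every later step reverses it twice, at the pairing and
    -- across the edge.
    have : ∀ j, j + 1 ≤ k → endSign σ (f (j + 1)) = -endSign σ h₀ := by
      intro j
      induction j with
      | zero => intro _; rw [fs, endSign_opp, f0, hp.fixed _ h₀B]
      | succ j ih =>
        intro hj
        rw [fs, endSign_opp, hσ _ (hlt _ (by omega) (by omega)), ih (by omega)]
        ring
    obtain ⟨i, hi⟩ : ∃ i, k = i + 1 := ⟨k - 1, by omega⟩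
    rw [hi]
    exact this i (by omega)

/-- Some strand of the pairing connects `a` and `b`. -/
def Connects (vert : X × Bool → V) (p : X × Bool → X × Bool) (a b : V) : Prop :=
  ∃ h h' : X × Bool, vert h = a ∧ vert h' = b ∧ strand p h.1 h'.1

/-- The contribution of a strand to the excess of an orientation. -/
noncomputable def strandExcess (vert : X × Bool → V) (p : X × Bool → X × Bool) (σ : X → Bool)
    (a : V) (K : Quotient (strand p)) : ℤ :=
  ∑ h : X × Bool, if vert h = a ∧ (Quotient.mk (strand p) h.1) = K then endSign σ h else 0

/-- A strand which meets `a` has exactly two half-edges in `{a, b}`, of opposite signs. If both lie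
at `a`, they cancel; otherwise the second one lies at `b` and the strand joins `a` to `b`. -/
theorem strandExcess_bound (a b : V) (hp : IsPairing vert {a, b} p) {σ : X → Bool}
    (hσ : Compat vert {a, b} p σ) (K : Quotient (strand p)) :
    strandExcess vert p σ a K = 0 ∨ |strandExcess vert p σ a K| ≤ 1 ∧ Connects vert p a b := by
  by_cases hK : ∃ h : X × Bool, vert h = a ∧ (Quotient.mk (strand p) h.1) = K
  swap
  · left
    refine Finset.sum_eq_zero fun h _ => ?_
    rw [if_neg fun hh => hK ⟨h, hh⟩]
  obtain ⟨h₀, h₀a, h₀K⟩ := hK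
  obtain ⟨h₁, h₁B, hs, honly, hsign⟩ := hp.exists_other_end h₀ (by simp [h₀a])
  have hsg := hsign σ hσ
  have hne : h₀ ≠ h₁ := by
    rintro rfl
    rcases endSign_eq σ h₀ with h | h <;> rw [h] at hsg <;> norm_num at hsg
  have hsum : strandExcess vert p σ a K = ∑ h ∈ ({h₀, h₁} : Finset (X × Bool)),
      if vert h = a ∧ (Quotient.mk (strand p) h.1) = K then endSign σ h else 0 := by
    symm
    refine Finset.sum_subset (Finset.subset_univ _) fun h _ hh => if_neg fun hc => hh ?_
    have : strand p h₀.1 h.1 := Quotient.exact (h₀K.trans hc.2.symm)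
    simpa using honly h (by simp [hc.1]) this
  have h₁K : (Quotient.mk (strand p) h₁.1) = K := by
    rw [← h₀K]; exact Quotient.sound ((strand p).symm hs)
  rw [Finset.sum_pair hne, if_pos ⟨h₀a, h₀K⟩, hsg] at hsum
  by_cases h₁a : vert h₁ = a
  · left
    rw [hsum, if_pos ⟨h₁a, h₁K⟩]
    ring
  · right
    rw [if_neg (fun h => h₁a h.1)] at hsum
    refine ⟨?_, h₀, h₁, h₀a, by simpa [h₁a] using h₁B, hs⟩
    rw [hsum]
    rcases endSign_eq σ h₀ with h | h <;> simp [h]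

/-- The compatible orientations of a pairing arise from each other by reversing strands. -/
theorem card_compat (a : V) (hp : IsPairing vert B p) {σ₀ : X → Bool}
    (hσ₀ : Compat vert B p σ₀) (m : ℤ) :
    Nat.card {σ : X → Bool // Compat vert B p σ ∧ excess vert σ a = m} =
      signCount (strandExcess vert p σ₀ a) m := by
  -- `ε K = true` keeps `σ₀` along the strand `K`, and `ε K = false` reverses it.
  have hflip : ∀ (ε : Quotient (strand p) → Bool) (h : X × Bool),
      endSign (fun x => ε (Quotient.mk (strand p) x) == σ₀ x) h =
        sgn (ε (Quotient.mk (strand p) h.1)) * endSign σ₀ h := by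
    rintro ε ⟨x, c⟩
    cases h1 : σ₀ x <;> cases h2 : ε (Quotient.mk (strand p) x) <;> cases c <;>
      simp [endSign, sgn, h1, h2]
  have hmk : ∀ h : X × Bool,
      Quotient.mk (strand p) (p h).1 = Quotient.mk (strand p) h.1 := fun h =>
    Quotient.sound ((strand p).symm (strand_pairing p h))
  have hexc : ∀ ε : Quotient (strand p) → Bool,
      excess vert (fun x => ε (Quotient.mk (strand p) x) == σ₀ x) a =
        ∑ K, sgn (ε K) * strandExcess vert p σ₀ a K := by
    intro ε
    rw [excess_eq_sum_endSign]
    simp only [strandExcess, Finset.mul_sum]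
    rw [Finset.sum_comm]
    refine Finset.sum_congr rfl fun h _ => ?_
    rw [hflip, Finset.sum_eq_single (Quotient.mk (strand p) h.1)]
    · by_cases ha : vert h = a <;> simp [ha]
    · intro K _ hK
      simp [hK.symm]
    · simp
  symm
  refine Nat.card_congr (Equiv.ofBijective
    (fun ε => ⟨fun x => ε.1 (Quotient.mk (strand p) x) == σ₀ x, ?_, by rw [hexc, ε.2]⟩) ⟨?_, ?_⟩)
  · intro h hB
    rw [hflip, hflip, hσ₀ h hB, hmk]
    ring
  · rintro ⟨ε, _⟩ ⟨ε', _⟩ h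
    simp only [Subtype.mk.injEq] at h ⊢
    funext K
    induction K using Quotient.inductionOn with
    | h x =>
      have := congrFun h x
      cases h1 : σ₀ x <;> simpa [h1] using this
  · rintro ⟨σ, hσ, hm⟩
    -- Outside `B` the pairing reverses the signs of both orientations, and in `B` it moves nothing,
    -- so agreement with `σ₀` is constant along strands.
    have hinv : ∀ x y, strand p x y → (σ x == σ₀ x) = (σ y == σ₀ y) := by
      intro x y hxy
      induction hxy with
      | rel x y h =>
        obtain ⟨c, rfl⟩ := h
        have key : endSign σ (p (x, c)) * endSign σ₀ (p (x, c)) =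
            endSign σ (x, c) * endSign σ₀ (x, c) := by
          rcases em (vert (x, c) ∈ B) with h | h
          · rw [hp.fixed _ h]
          · rw [hσ _ h, hσ₀ _ h]; ring
        rcases hpx : p (x, c) with ⟨y, d⟩
        rw [hpx] at key
        cases h1 : σ x <;> cases h2 : σ y <;> cases h3 : σ₀ x <;> cases h4 : σ₀ y <;>
          cases c <;> cases d <;> simp [endSign, h1, h2, h3, h4] at key ⊢
      | refl x => rfl
      | symm x y _ ih => exact ih.symm
      | trans x y z _ _ ih1 ih2 => exact ih1.trans ih2
    have hσe : (fun x => Quotient.lift (s := strand p) (fun x => σ x == σ₀ x) hinv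
        (Quotient.mk (strand p) x) == σ₀ x) = σ := by
      funext x
      simp only [Quotient.lift_mk]
      cases σ x <;> cases σ₀ x <;> rfl
    refine ⟨⟨Quotient.lift (s := strand p) (fun x => σ x == σ₀ x) hinv, ?_⟩, ?_⟩
    · rw [← hexc, hσe, hm]
    · simp only [Subtype.mk.injEq]
      exact hσe

/-- If no strand joins `a` to `b`, no strand contributes to the excess at `a`, and excess 2 is
impossible. Otherwise the condition on strands is vacuous and `signCount_le` applies. -/
theorem card_compat_le (a b : V) (hp : IsPairing vert {a, b} p) :
    Nat.card {σ : X → Bool // Compat vert {a, b} p σ ∧ excess vert σ a = 2} ≤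
      Nat.card {σ : X → Bool // (Compat vert {a, b} p σ ∧ excess vert σ a = 0) ∧
        Connects vert p a b} := by
  by_cases hne : ∃ σ, Compat vert {a, b} p σ ∧ excess vert σ a = 2
  swap
  · have : IsEmpty {σ : X → Bool // Compat vert {a, b} p σ ∧ excess vert σ a = 2} :=
      ⟨fun σ => hne ⟨σ.1, σ.2⟩⟩
    simp
  obtain ⟨σ₀, hσ₀, h2⟩ := hne
  have hc : Connects vert p a b := by
    by_contra hc
    have ht : strandExcess vert p σ₀ a = 0 := by
      funext K
      rcases strandExcess_bound a b hp hσ₀ K with h | h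
      · exact h
      · exact absurd h.2 hc
    have := card_compat a hp hσ₀ 2
    rw [ht] at this
    have h0 : signCount (0 : Quotient (strand p) → ℤ) 2 = 0 := by
      rw [signCount]
      have : IsEmpty {ε : Quotient (strand p) → Bool //
          ∑ K, sgn (ε K) * (0 : Quotient (strand p) → ℤ) K = 2} :=
        ⟨fun ε => by have := ε.2; simp at this⟩
      simp
    rw [h0, Nat.card_eq_zero] at this
    rcases this with h | h
    · exact h.false ⟨σ₀, hσ₀, h2⟩
    · exact h.not_finite inferInstance
  simp only [hc, and_true]
  rw [card_compat a hp hσ₀, card_compat a hp hσ₀]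
  refine signCount_le _ (fun K => ?_) _ _ (by norm_num) (by norm_num)
  rcases strandExcess_bound a b hp hσ₀ K with h | h
  · rw [h]; norm_num
  · exact h.1

end Combinatorics

end XYIsing

namespace XYIsing

/-! ### Pairings as partial successor maps, and the comparison with loop decompositions -/

section Combinatorics

open scoped Classical Nat

variable {V X : Type*} {vert : X × Bool → V} {B : Set V} {p : X × Bool → X × Bool}

theorem endSign_eq_one {X : Type*} {σ : X → Bool} {h : X × Bool} :
    endSign σ h = 1 ↔ h = (h.1, σ h.1) := by
  rcases h with ⟨x, c⟩
  by_cases hc : c = σ x <;> simp [endSign, hc]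

theorem endSign_eq_neg_one {X : Type*} {σ : X → Bool} {h : X × Bool} :
    endSign σ h = -1 ↔ h = (h.1, !σ h.1) := by
  rcases h with ⟨x, c⟩
  cases c <;> cases hs : σ x <;> simp [endSign, hs]

theorem pairing_head {σ : X → Bool} (hσ : Compat vert B p σ) {x : X} (hx : head vert σ x ∉ B) :
    p (x, !σ x) = ((p (x, !σ x)).1, σ (p (x, !σ x)).1) := by
  rw [← endSign_eq_one, hσ _ hx, endSign_eq_neg_one.2 rfl, neg_neg]

theorem pairing_tail {σ : X → Bool} (hσ : Compat vert B p σ) {x : X} (hx : tail vert σ x ∉ B) :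
    p (x, σ x) = ((p (x, σ x)).1, !σ (p (x, σ x)).1) := by
  rw [← endSign_eq_neg_one, hσ _ hx, endSign_eq_one.2 rfl]

/-- The successor map of a pairing outside of `B`. -/
noncomputable def successorEquiv {σ : X → Bool} (hp : IsPairing vert B p)
    (hσ : Compat vert B p σ) : {x // head vert σ x ∉ B} ≃ {x // tail vert σ x ∉ B} where
  toFun x := ⟨(p (x.1, !σ x.1)).1, by
    rw [tail, ← pairing_head hσ x.2, hp.vert_eq]; exact x.2⟩
  invFun x := ⟨(p (x.1, σ x.1)).1, by
    rw [head, ← pairing_tail hσ x.2, hp.vert_eq]; exact x.2⟩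
  left_inv x := by
    ext
    simp only
    rw [← pairing_head hσ x.2, hp.invol]
  right_inv x := by
    ext
    simp only
    rw [← pairing_tail hσ x.2, hp.invol]

theorem tail_successorEquiv {σ : X → Bool} (hp : IsPairing vert B p)
    (hσ : Compat vert B p σ) (x : {x // head vert σ x ∉ B}) :
    tail vert σ (successorEquiv hp hσ x).1 = head vert σ x.1 := by
  change tail vert σ (p (x.1, !σ x.1)).1 = _
  rw [tail, ← pairing_head hσ x.2, hp.vert_eq]; rfl

/-- The pairing given by a successor map. -/
noncomputable def pairingOf {σ : X → Bool}
    (E : {x // head vert σ x ∉ B} ≃ {x // tail vert σ x ∉ B}) (h : X × Bool) : X × Bool :=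
  if h.2 = σ h.1 then
    if ht : tail vert σ h.1 ∉ B then ((E.symm ⟨h.1, ht⟩).1, !σ (E.symm ⟨h.1, ht⟩).1) else h
  else if hh : head vert σ h.1 ∉ B then ((E ⟨h.1, hh⟩).1, σ (E ⟨h.1, hh⟩).1) else h

theorem pairingOf_tail {σ : X → Bool}
    (E : {x // head vert σ x ∉ B} ≃ {x // tail vert σ x ∉ B}) (x : {x // tail vert σ x ∉ B}) :
    pairingOf E (x.1, σ x.1) = ((E.symm x).1, !σ (E.symm x).1) := by
  simp [pairingOf, x.2]

theorem pairingOf_head {σ : X → Bool}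
    (E : {x // head vert σ x ∉ B} ≃ {x // tail vert σ x ∉ B}) (x : {x // head vert σ x ∉ B}) :
    pairingOf E (x.1, !σ x.1) = ((E x).1, σ (E x).1) := by
  simp [pairingOf, x.2]

theorem pairingOf_of_mem {σ : X → Bool}
    (E : {x // head vert σ x ∉ B} ≃ {x // tail vert σ x ∉ B}) {h : X × Bool} (hB : vert h ∈ B) :
    pairingOf E h = h := by
  rcases endSign_eq σ h with h1 | h1
  · rw [endSign_eq_one] at h1
    have ht : tail vert σ h.1 ∈ B := by rw [tail, ← h1]; exact hB
    rw [pairingOf, if_pos (congrArg Prod.snd h1), dif_neg (not_not.2 ht)]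
  · rw [endSign_eq_neg_one] at h1
    have ht : head vert σ h.1 ∈ B := by rw [head, ← h1]; exact hB
    have hne : h.2 ≠ σ h.1 := fun h2 => by simpa [h2] using congrArg Prod.snd h1
    rw [pairingOf, if_neg hne, dif_neg (not_not.2 ht)]

theorem cases_end {σ : X → Bool} (h : X × Bool) : vert h ∈ B ∨
    (∃ x : {x // tail vert σ x ∉ B}, h = (x.1, σ x.1)) ∨
    ∃ x : {x // head vert σ x ∉ B}, h = (x.1, !σ x.1) := by
  by_cases hB : vert h ∈ B
  · exact Or.inl hB
  · rcases endSign_eq σ h with h1 | h1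
    · rw [endSign_eq_one] at h1
      exact Or.inr (Or.inl ⟨⟨h.1, by rw [tail, ← h1]; exact hB⟩, h1⟩)
    · rw [endSign_eq_neg_one] at h1
      exact Or.inr (Or.inr ⟨⟨h.1, by rw [head, ← h1]; exact hB⟩, h1⟩)

theorem isPairing_pairingOf {σ : X → Bool}
    (E : {x // head vert σ x ∉ B} ≃ {x // tail vert σ x ∉ B})
    (hE : ∀ x, tail vert σ (E x).1 = head vert σ x.1) : IsPairing vert B (pairingOf E) where
  invol h := by
    rcases cases_end (vert := vert) (B := B) (σ := σ) h with hB | ⟨x, rfl⟩ | ⟨x, rfl⟩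
    · rw [pairingOf_of_mem E hB, pairingOf_of_mem E hB]
    · rw [pairingOf_tail, pairingOf_head, E.apply_symm_apply]
    · rw [pairingOf_head, pairingOf_tail, E.symm_apply_apply]
  vert_eq h := by
    rcases cases_end (vert := vert) (B := B) (σ := σ) h with hB | ⟨x, rfl⟩ | ⟨x, rfl⟩
    · rw [pairingOf_of_mem E hB]
    · rw [pairingOf_tail]
      have := hE (E.symm x)
      rw [E.apply_symm_apply] at this
      exact this.symm
    · rw [pairingOf_head]
      exact hE x
  fixed h hB := pairingOf_of_mem E hB

theorem compat_pairingOf {σ : X → Bool}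
    (E : {x // head vert σ x ∉ B} ≃ {x // tail vert σ x ∉ B}) :
    Compat vert B (pairingOf E) σ := by
  intro h hB
  rcases cases_end (vert := vert) (B := B) (σ := σ) h with hB' | ⟨x, rfl⟩ | ⟨x, rfl⟩
  · exact absurd hB' hB
  · rw [pairingOf_tail, endSign_eq_neg_one.2 rfl, endSign_eq_one.2 rfl]
  · rw [pairingOf_head, endSign_eq_one.2 rfl, endSign_eq_neg_one.2 rfl, neg_neg]

/-- The pairings which are compatible with an orientation are given by successor maps. -/
noncomputable def pairingEquiv (vert : X × Bool → V) (B : Set V) (σ : X → Bool) :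
    {p // IsPairing vert B p ∧ Compat vert B p σ} ≃
      {E : {x // head vert σ x ∉ B} ≃ {x // tail vert σ x ∉ B} //
        ∀ x, tail vert σ (E x).1 = head vert σ x.1} where
  toFun p := ⟨successorEquiv p.2.1 p.2.2, tail_successorEquiv p.2.1 p.2.2⟩
  invFun E := ⟨pairingOf E.1, isPairing_pairingOf E.1 E.2, compat_pairingOf E.1⟩
  left_inv p := by
    obtain ⟨p, hp, hσ⟩ := p
    ext1
    funext h
    rcases cases_end (vert := vert) (B := B) (σ := σ) h with hB' | ⟨x, rfl⟩ | ⟨x, rfl⟩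
    · exact (pairingOf_of_mem _ hB').trans (hp.fixed _ hB').symm
    · exact (pairingOf_tail _ _).trans (pairing_tail hσ x.2).symm
    · exact (pairingOf_head _ _).trans (pairing_head hσ x.2).symm
  right_inv E := by
    ext x
    change (pairingOf E.1 (x.1, !σ x.1)).1 = _
    rw [pairingOf_head]

/-- A strand step through a head outside `B` is a step of `π`, and one through a tail is a step of
`π` backwards. Hence it does not matter how `π` continues at the vertices of `B`. -/
theorem sameCycle_of_strand {σ : X → Bool} (hp : IsPairing vert B p) (hσ : Compat vert B p σ)
    (π : Equiv.Perm X) (hπ : ∀ x : {x // head vert σ x ∉ B}, π x.1 = (successorEquiv hp hσ x).1)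
    {x y : X} (h : strand p x y) : π.SameCycle x y := by
  induction h with
  | rel x y h =>
    obtain ⟨c, rfl⟩ := h
    rcases cases_end (vert := vert) (B := B) (σ := σ) (x, c) with hB' | ⟨z, hz⟩ | ⟨z, hz⟩
    · rw [hp.fixed _ hB']
    · rw [hz]
      obtain rfl : x = z.1 := congrArg Prod.fst hz
      have := hπ ((successorEquiv hp hσ).symm z)
      rw [Equiv.apply_symm_apply] at this
      change π (p (z.1, σ z.1)).1 = z.1 at this
      refine Equiv.Perm.SameCycle.symm ⟨1, ?_⟩
      simpa using this
    · rw [hz]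
      obtain rfl : x = z.1 := congrArg Prod.fst hz
      refine ⟨1, ?_⟩
      rw [zpow_one]
      exact hπ z
  | refl x => exact Equiv.Perm.SameCycle.refl _ _
  | symm x y _ ih => exact ih.symm
  | trans x y z _ _ ih1 ih2 => exact ih1.trans ih2

variable [Fintype X]

theorem card_subtype_fiber {α ι : Type*} [Finite α] (P : ι → Prop) (f : α → ι) (i : ι) :
    Nat.card {x : {x // P (f x)} // f x.1 = i} = if P i then Nat.card {x // f x = i} else 0 := by
  split_ifs with h
  · refine Nat.card_congr ((Equiv.subtypeSubtypeEquivSubtypeInter _ (fun x => f x = i)).trans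
      (Equiv.subtypeEquivRight fun x => ⟨fun hx => hx.2, fun hx => ⟨by rw [hx]; exact h, hx⟩⟩))
  · have : IsEmpty {x : {x // P (f x)} // f x.1 = i} := ⟨fun x => h (by rw [← x.2]; exact x.1.2)⟩
    simp

/-- The number of successor maps over the vertices with `P`. -/
theorem card_successor_subtype [Fintype V] (P : V → Prop) [DecidablePred P] {σ : X → Bool}
    (h : ∀ v, P v → excess vert σ v = 0) :
    Nat.card {E : {x // P (head vert σ x)} ≃ {x // P (tail vert σ x)} //
        ∀ x, tail vert σ (E x).1 = head vert σ x.1} =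
      ∏ v, if P v then (endCount vert v / 2)! else 1 := by
  rw [card_equiv_over (fun x : {x // P (head vert σ x)} => head vert σ x.1)
    (fun x : {x // P (tail vert σ x)} => tail vert σ x.1) fun v => ?_]
  · refine Finset.prod_congr rfl fun v _ => ?_
    rw [card_subtype_fiber]
    split_ifs with hv
    · rw [card_head_eq vert (h v hv)]
    · rfl
  · rw [card_subtype_fiber, card_subtype_fiber]
    split_ifs with hv
    · exact (card_tail_eq_card_head vert (h v hv)).symm
    · rfl

/-- The count needs balance only outside `B`, so it is the same for balanced orientations and for
those with sources in `B`. -/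
theorem card_pairing [Fintype V] (vert : X × Bool → V) (B : Set V) {σ : X → Bool}
    (h : ∀ v ∉ B, excess vert σ v = 0) :
    Nat.card {p // IsPairing vert B p ∧ Compat vert B p σ} =
      ∏ v, if v ∉ B then (endCount vert v / 2)! else 1 := by
  rw [Nat.card_congr (pairingEquiv vert B σ)]
  exact card_successor_subtype (fun v => v ∉ B) h

theorem excess_eq_zero_of_compat {σ : X → Bool} (hp : IsPairing vert B p)
    (hσ : Compat vert B p σ) {v : V} (hv : v ∉ B) : excess vert σ v = 0 := by
  rw [excess_eq_sum_endSign, ← Finset.sum_filter]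
  refine Finset.sum_involution (fun h _ => p h) ?_ ?_ ?_ ?_
  · intro h hh
    rw [hσ h (by rw [(Finset.mem_filter.1 hh).2]; exact hv), add_neg_cancel]
  · intro h hh hne heq
    have := hσ h (by rw [(Finset.mem_filter.1 hh).2]; exact hv)
    rw [heq] at this
    omega
  · intro h hh
    rw [Finset.mem_filter] at hh ⊢
    exact ⟨Finset.mem_univ _, by rw [hp.vert_eq, hh.2]⟩
  · intro h _
    exact hp.invol h

/-- The total excess vanishes, so balance at all vertices but `b` forces balance at `b`. -/
theorem excess_eq_zero_of_compat_pair [Fintype V] {a b : V} {σ : X → Bool}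
    (hp : IsPairing vert {a, b} p) (hσ : Compat vert {a, b} p σ) (ha : excess vert σ a = 0) (v : V) :
    excess vert σ v = 0 := by
  by_cases hv : v = b
  · subst hv
    rw [← sum_excess vert σ, eq_comm]
    refine Finset.sum_eq_single v (fun w _ hw => ?_) (by simp)
    by_cases hwa : w = a
    · rw [hwa, ha]
    · exact excess_eq_zero_of_compat hp hσ (by simp [hw, hwa])
  · by_cases hva : v = a
    · rw [hva, ha]
    · exact excess_eq_zero_of_compat hp hσ (by simp [hv, hva])

/-- A loop passes through both `a` and `b`. -/
def LoopConnects (vert : X × Bool → V) (π : Equiv.Perm X) (a b : V) : Prop :=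
  ∃ h h' : X × Bool, vert h = a ∧ vert h' = b ∧ π.SameCycle h.1 h'.1

theorem subtypeCongr_apply_of_pos {α : Type*} {P Q : α → Prop} [DecidablePred P]
    [DecidablePred Q] (e : {x // P x} ≃ {x // Q x}) (f : {x // ¬P x} ≃ {x // ¬Q x}) {x : α}
    (hx : P x) : Equiv.subtypeCongr e f x = (e ⟨x, hx⟩).1 := by
  simp [Equiv.subtypeCongr, Equiv.sumCompl_symm_apply_of_pos hx]

theorem subtypeCongr_apply_of_neg {α : Type*} {P Q : α → Prop} [DecidablePred P]
    [DecidablePred Q] (e : {x // P x} ≃ {x // Q x}) (f : {x // ¬P x} ≃ {x // ¬Q x}) {x : α}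
    (hx : ¬P x) : Equiv.subtypeCongr e f x = (f ⟨x, hx⟩).1 := by
  simp [Equiv.subtypeCongr, Equiv.sumCompl_symm_apply_of_neg hx]

/-- The successor map of the pairing and an arbitrary successor map at `a` and `b` glue to a
permutation, from which both can be recovered. A strand from `a` to `b` stays inside one of its
cycles. -/
theorem card_connecting_pairing_mul_le [Fintype V] {a b : V} {σ : X → Bool}
    (h : ∀ v, excess vert σ v = 0) :
    Nat.card {p // (IsPairing vert {a, b} p ∧ Compat vert {a, b} p σ) ∧ Connects vert p a b} *
        (∏ v, if ¬v ∉ ({a, b} : Set V) then (endCount vert v / 2)! else 1) ≤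
      Nat.card {π : Equiv.Perm X // (∀ x, tail vert σ (π x) = head vert σ x) ∧
        LoopConnects vert π a b} := by
  have hF := card_successor_subtype (fun v => ¬v ∉ ({a, b} : Set V)) (fun v _ => h v)
  rw [← hF, ← Nat.card_prod]
  refine Nat.card_le_card_of_injective (fun q => ⟨Equiv.subtypeCongr
    (successorEquiv q.1.2.1.1 q.1.2.1.2) q.2.1, ?_, ?_⟩) ?_
  · intro x
    by_cases hx : head vert σ x ∉ ({a, b} : Set V)
    · rw [subtypeCongr_apply_of_pos (P := fun x => head vert σ x ∉ ({a, b} : Set V)) _ _ hx]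
      exact tail_successorEquiv q.1.2.1.1 q.1.2.1.2 ⟨x, hx⟩
    · rw [subtypeCongr_apply_of_neg (P := fun x => head vert σ x ∉ ({a, b} : Set V)) _ _ hx]
      exact q.2.2 ⟨x, hx⟩
  · obtain ⟨h₁, h₂, h1, h2, hs⟩ := q.1.2.2
    refine ⟨h₁, h₂, h1, h2, sameCycle_of_strand q.1.2.1.1 q.1.2.1.2 _ ?_ hs⟩
    exact fun x => subtypeCongr_apply_of_pos
      (P := fun x => head vert σ x ∉ ({a, b} : Set V)) _ _ x.2
  · rintro ⟨⟨p, ⟨hp, hσ⟩, hc⟩, ⟨F, hF⟩⟩ ⟨⟨p', ⟨hp', hσ'⟩, hc'⟩, ⟨F', hF'⟩⟩ heq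
    simp only [Subtype.mk.injEq] at heq
    have hE : successorEquiv hp hσ = successorEquiv hp' hσ' := by
      ext x
      have := congrArg (fun π : Equiv.Perm X => π x.1) heq
      rwa [subtypeCongr_apply_of_pos (P := fun x => head vert σ x ∉ ({a, b} : Set V)) _ _ x.2,
        subtypeCongr_apply_of_pos (P := fun x => head vert σ x ∉ ({a, b} : Set V)) _ _ x.2] at this
    have hFF : F = F' := by
      ext x
      have := congrArg (fun π : Equiv.Perm X => π x.1) heq
      rwa [subtypeCongr_apply_of_neg (P := fun x => head vert σ x ∉ ({a, b} : Set V)) _ _ x.2,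
        subtypeCongr_apply_of_neg (P := fun x => head vert σ x ∉ ({a, b} : Set V)) _ _ x.2] at this
    have hpp : p = p' := by
      have : (⟨p, hp, hσ⟩ : {p // IsPairing vert {a, b} p ∧ Compat vert {a, b} p σ}) =
          ⟨p', hp', hσ'⟩ := (pairingEquiv vert {a, b} σ).injective (Subtype.ext hE)
      exact congrArg Subtype.val this
    subst hpp hFF
    rfl

theorem card_filter_eq {α : Type*} [Fintype α] (P : α → Prop) [DecidablePred P] :
    Nat.card {x // P x} = ∑ x, if P x then 1 else 0 := by
  rw [Nat.card_eq_fintype_card, Fintype.card_subtype, Finset.card_filter]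

/-- Orientations with sources at `a` and `b`, together with pairings at every vertex, are at most
as many as the decompositions of the multigraph into loops, one of them through `a` and `b`. -/
theorem card_source_mul_le [Fintype V] (vert : X × Bool → V) {a b : V} {f : V → ℤ} (ha : f a = 2)
    (hf : ∀ v, v ≠ a → v ≠ b → f v = 0) :
    Nat.card {σ : X → Bool // ∀ v, excess vert σ v = f v} *
        ∏ v, (endCount vert v / 2)! ≤
      Nat.card {q : (X → Bool) × Equiv.Perm X // (∀ x, tail vert q.1 (q.2 x) = head vert q.1 x) ∧
        LoopConnects vert q.2 a b} := by
  set B : Set V := {a, b} with hB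
  -- `m₁` counts the pairings away from `a` and `b`, and `m₂` the ways to close the strands up at
  -- `a` and `b`.
  set m₁ := ∏ v, if v ∉ B then (endCount vert v / 2)! else 1
  set m₂ := ∏ v, if ¬v ∉ B then (endCount vert v / 2)! else 1
  have hm : ∏ v, (endCount vert v / 2)! = m₁ * m₂ := by
    rw [← Finset.prod_mul_distrib]
    refine Finset.prod_congr rfl fun v _ => ?_
    by_cases hv : v ∈ B <;> simp [hv]
  set Src : (X → Bool) → Prop := fun σ =>
    ∀ v, excess vert σ v = f v
  have hsrcB : ∀ σ, Src σ → ∀ v ∉ B, excess vert σ v = 0 := by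
    intro σ hσ v hv
    simp only [hB, Set.mem_insert_iff, Set.mem_singleton_iff, not_or] at hv
    rw [hσ v, hf v hv.1 hv.2]
  calc Nat.card {σ // Src σ} * ∏ v, (endCount vert v / 2)!
      = (∑ σ, if Src σ then m₁ else 0) * m₂ := by
        rw [hm, card_filter_eq, ← mul_assoc, Finset.sum_mul]
        simp only [ite_mul, one_mul, zero_mul]
    _ = (∑ σ, ∑ p, if Src σ ∧ IsPairing vert B p ∧ Compat vert B p σ then 1 else 0) * m₂ := by
        congr 1
        refine Finset.sum_congr rfl fun σ _ => ?_
        split_ifs with hσ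
        · have hm₁ : m₁ = Nat.card {p // IsPairing vert B p ∧ Compat vert B p σ} := by
            rw [card_pairing vert B (hsrcB σ hσ)]
            exact Finset.prod_congr rfl fun v _ => by congr
          rw [hm₁, card_filter_eq]
          simp [hσ]
        · simp [hσ]
    _ ≤ (∑ p, ∑ σ, if (∀ v, excess vert σ v = 0) ∧
          (IsPairing vert B p ∧ Compat vert B p σ) ∧ Connects vert p a b then 1 else 0) * m₂ := by
        -- With the pairing fixed, the orientations are compared by reversing strands.
        rw [Finset.sum_comm]
        refine Nat.mul_le_mul_right _ (Finset.sum_le_sum fun p _ => ?_)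
        by_cases hp : IsPairing vert B p
        · calc _ ≤ ∑ σ, if Compat vert B p σ ∧ excess vert σ a = 2 then 1 else 0 := by
                refine Finset.sum_le_sum fun σ _ => ?_
                split_ifs with h1 h2
                · exact le_rfl
                · refine absurd ⟨h1.2.2, ?_⟩ h2
                  rw [h1.1 a, ha]
                · exact zero_le_one
                · exact le_rfl
            _ = _ := (card_filter_eq _).symm
            _ ≤ _ := card_compat_le a b hp
            _ = _ := card_filter_eq _
            _ ≤ _ := by
                refine Finset.sum_le_sum fun σ _ => ?_
                split_ifs with h1 h2
                · exact le_rfl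
                · exact absurd ⟨excess_eq_zero_of_compat_pair hp h1.1.1 h1.1.2,
                    ⟨hp, h1.1.1⟩, h1.2⟩ h2
                · exact zero_le_one
                · exact le_rfl
        · simp [hp]
    _ = ∑ σ, if ∀ v, excess vert σ v = 0 then
          Nat.card {p // (IsPairing vert B p ∧ Compat vert B p σ) ∧ Connects vert p a b} * m₂
          else 0 := by
        rw [Finset.sum_comm, Finset.sum_mul]
        refine Finset.sum_congr rfl fun σ _ => ?_
        split_ifs with h1
        · rw [card_filter_eq]
          simp [h1]
        · simp [h1]
    _ ≤ ∑ σ, Nat.card {π : Equiv.Perm X // (∀ x, tail vert σ (π x) = head vert σ x) ∧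
          LoopConnects vert π a b} := by
        refine Finset.sum_le_sum fun σ _ => ?_
        split_ifs with h1
        · exact card_connecting_pairing_mul_le h1
        · exact Nat.zero_le _
    _ = _ := by
        rw [card_filter_eq, Fintype.sum_prod_type]
        exact Finset.sum_congr rfl fun σ _ => card_filter_eq _

/-- The number of decompositions of a multigraph into loops. -/
theorem card_loop_decomposition [Fintype V] (vert : X × Bool → V) (P : Prop) :
    Nat.card {q : (X → Bool) × Equiv.Perm X //
        (∀ x, tail vert q.1 (q.2 x) = head vert q.1 x) ∧ P} =
      if P then Nat.card {σ : X → Bool // ∀ v, excess vert σ v = 0} *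
        ∏ v, (endCount vert v / 2)! else 0 := by
  split_ifs with hP
  · simp only [hP, and_true]
    rw [card_filter_eq, Fintype.sum_prod_type, card_filter_eq, Finset.sum_mul]
    refine Finset.sum_congr rfl fun σ _ => ?_
    rw [← card_filter_eq (fun π : Equiv.Perm X => ∀ x, tail vert σ (π x) = head vert σ x)]
    split_ifs with h
    · rw [card_successor vert h, one_mul]
    · have : IsEmpty {π : Equiv.Perm X // ∀ x, tail vert σ (π x) = head vert σ x} :=
        ⟨fun π => h (excess_eq_zero_of_perm vert π.1 π.2)⟩
      simp
  · simp [hP]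

end Combinatorics

end XYIsing

namespace XYIsing

set_option linter.unusedSectionVars false

section EdgeCopies

open scoped Nat

variable {V : Type*} [Fintype V] [DecidableEq V] {G : SimpleGraph V} [DecidableRel G.Adj]

/-! ### Cycle decompositions as orientations with successor permutations -/

theorem exists_dart_edge_eq {V : Type*} {G : SimpleGraph V} (e : G.edgeSet) : ∃ a : G.Dart, a.edge = e := by
  obtain ⟨e, he⟩ := e
  induction e using Sym2.ind with
  | _ i j => exact ⟨⟨(i, j), he⟩, rfl⟩

/-- A reference direction of every edge. -/
noncomputable def refDart (e : G.edgeSet) : G.Dart := (exists_dart_edge_eq e).choose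

theorem refDart_edge (e : G.edgeSet) : (refDart e).edge = e := (exists_dart_edge_eq e).choose_spec

theorem dart_edge_eq_iff (a : G.Dart) (e : G.edgeSet) :
    a.edge = e ↔ a = refDart e ∨ a = (refDart e).symm := by
  rw [← refDart_edge e, SimpleGraph.dart_edge_eq_iff]

/-- The edge copy with one of its two directions. -/
noncomputable def dartOf {n : G.edgeSet → ℕ} (h : EdgeCopy n × Bool) : G.Dart :=
  if h.2 then refDart h.1.1 else (refDart h.1.1).symm

/-- The ends of the edge copies. -/
noncomputable def vertOf (n : G.edgeSet → ℕ) (h : EdgeCopy n × Bool) : V := (dartOf h).fst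

variable {n : G.edgeSet → ℕ}

theorem dartOf_edge (h : EdgeCopy n × Bool) : (dartOf h).edge = h.1.1 := by
  unfold dartOf
  split_ifs
  · exact refDart_edge _
  · rw [SimpleGraph.Dart.edge_symm]; exact refDart_edge _

theorem dartOf_not (x : EdgeCopy n) (c : Bool) : dartOf (x, !c) = (dartOf (x, c)).symm := by
  cases c <;> simp [dartOf]

theorem vertOf_not (x : EdgeCopy n) (c : Bool) : vertOf n (x, !c) = (dartOf (x, c)).snd := by
  rw [vertOf, dartOf_not]; rfl

theorem mem_iff_exists_vertOf (x : EdgeCopy n) (v : V) :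
    v ∈ (x.1 : Sym2 V) ↔ ∃ c, vertOf n (x, c) = v := by
  have h1 : (x.1 : Sym2 V) = s((dartOf (x, true)).fst, (dartOf (x, true)).snd) :=
    (dartOf_edge (x, true)).symm
  rw [h1, Sym2.mem_iff, Bool.exists_bool, ← vertOf_not, vertOf]
  simp only [Bool.not_true, vertOf]
  constructor
  · rintro (h | h)
    · exact Or.inr h.symm
    · exact Or.inl h.symm
  · rintro (h | h)
    · exact Or.inr h.symm
    · exact Or.inl h.symm

theorem dartOf_decide (x : EdgeCopy n) {a : G.Dart} (ha : a.edge = x.1) :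
    dartOf (x, decide (a = refDart x.1)) = a := by
  rcases (dart_edge_eq_iff a x.1).1 ha with h | h
  · simp [dartOf, h]
  · have : ¬a = refDart x.1 := by rw [h]; exact SimpleGraph.Dart.symm_ne _
    simp only [this, decide_false]
    exact h.symm

theorem decide_dartOf (x : EdgeCopy n) (c : Bool) :
    decide (dartOf (x, c) = refDart x.1) = c := by
  cases c <;> simp [dartOf, SimpleGraph.Dart.symm_ne]

theorem CycleDecomposition.ext_dir_next {C D : CycleDecomposition n} (h : C.dir = D.dir)
    (h' : C.next = D.next) : C = D := by
  cases C; cases D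
  simp only at h h'
  subst h h'
  rfl

/-- Cycle decompositions are orientations of the edge copies together with a successor
permutation. -/
noncomputable def cycleDecompositionEquiv (n : G.edgeSet → ℕ) :
    CycleDecomposition n ≃ {q : (EdgeCopy n → Bool) × Equiv.Perm (EdgeCopy n) //
      ∀ x, tail (vertOf n) q.1 (q.2 x) = head (vertOf n) q.1 x} where
  toFun C := ⟨(fun x => decide (C.dir x = refDart x.1), C.next), fun x => by
    simp only [tail, head]
    rw [vertOf_not, vertOf, dartOf_decide _ (C.dir_edge _), dartOf_decide _ (C.dir_edge _)]
    exact C.next_fst x⟩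
  invFun q :=
    { dir := fun x => dartOf (x, q.1.1 x)
      dir_edge := fun x => dartOf_edge _
      next := q.1.2
      next_fst := fun x => by
        have := q.2 x
        rw [tail, head, vertOf_not] at this
        exact this }
  left_inv C := by
    refine CycleDecomposition.ext_dir_next ?_ rfl
    funext x
    exact dartOf_decide x (C.dir_edge x)
  right_inv q := by
    obtain ⟨⟨σ, π⟩, h⟩ := q
    simp only [Subtype.mk.injEq, Prod.mk.injEq, and_true]
    funext x
    exact decide_dartOf x (σ x)

instance (n : G.edgeSet → ℕ) : Finite (CycleDecomposition n) :=
  Finite.of_equiv _ (cycleDecompositionEquiv n).symm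

theorem endCount_vertOf (v : V) : endCount (vertOf n) v = currentDegree n v := by
  classical
  rw [endCount, card_filter_eq, Fintype.sum_prod_type, currentDegree]
  rw [Fintype.sum_sigma]
  refine Finset.sum_congr rfl fun e _ => ?_
  rcases Nat.eq_zero_or_pos (n e) with h0 | h0
  · have : IsEmpty (Fin (n e)) := by rw [h0]; infer_instance
    simp [h0]
  have key : ∀ i : Fin (n e), (∑ c, if vertOf n (⟨e, i⟩, c) = v then 1 else 0) =
      if v ∈ (e : Sym2 V) then 1 else 0 := by
    intro i
    have hm := mem_iff_exists_vertOf (n := n) ⟨e, i⟩ v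
    -- The graph has no loops, so an edge copy has at most one end at `v`.
    have hne : vertOf n (⟨e, i⟩, true) ≠ vertOf n (⟨e, i⟩, false) := by
      rw [show false = !true from rfl, vertOf_not]
      exact (dartOf (⟨e, i⟩, true)).fst_ne_snd
    simp only [Fintype.sum_bool]
    rw [Bool.exists_bool] at hm
    by_cases h1 : vertOf n (⟨e, i⟩, true) = v <;> by_cases h2 : vertOf n (⟨e, i⟩, false) = v
    · exact absurd (h1.trans h2.symm) hne
    · simp [h1, h2, hm]
    · simp [h1, h2, hm]
    · simp [h1, h2, hm]
  rw [Finset.sum_congr rfl fun i _ => key i]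
  simp

/-- The number of orientations of the edge copies with given excess. -/
noncomputable def orientationCount (n : G.edgeSet → ℕ) (f : V → ℤ) : ℕ :=
  Nat.card {σ : EdgeCopy n → Bool // ∀ v, excess (vertOf n) σ v = f v}

theorem card_cycleDecomposition (n : G.edgeSet → ℕ) :
    Nat.card (CycleDecomposition n) =
      orientationCount n 0 * ∏ v, (currentDegree n v / 2)! := by
  classical
  have := card_loop_decomposition (vertOf n) True
  simp only [and_true, if_true, endCount_vertOf] at this
  rw [Nat.card_congr (cycleDecompositionEquiv n), this]
  rfl

theorem mem_cyclePercolation_iff {x y : V} (C : CycleDecomposition n) :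
    (⟨n, C⟩ : Σ n : G.edgeSet → ℕ, CycleDecomposition n) ∈ cyclePercolation x y ↔
      x = y ∨ LoopConnects (vertOf n) C.next x y := by
  refine or_congr Iff.rfl ⟨?_, ?_⟩
  · rintro ⟨a, b, hab, ha, hb⟩
    obtain ⟨c, hc⟩ := (mem_iff_exists_vertOf a x).1 ha
    obtain ⟨d, hd⟩ := (mem_iff_exists_vertOf b y).1 hb
    exact ⟨(a, c), (b, d), hc, hd, hab⟩
  · rintro ⟨⟨a, c⟩, ⟨b, d⟩, hc, hd, hab⟩
    exact ⟨a, b, hab, (mem_iff_exists_vertOf a x).2 ⟨c, hc⟩, (mem_iff_exists_vertOf b y).2 ⟨d, hd⟩⟩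

theorem orientationCount_mul_le {x y : V} (hxy : x ≠ y) {f : V → ℤ} (hx : f x = 2)
    (hf : ∀ v, v ≠ x → v ≠ y → f v = 0) :
    orientationCount n f * ∏ v, (currentDegree n v / 2)! ≤
      Nat.card {C : CycleDecomposition n //
        (⟨n, C⟩ : Σ n : G.edgeSet → ℕ, CycleDecomposition n) ∈ cyclePercolation x y} := by
  have h := card_source_mul_le (vertOf n) hx hf
  simp only [endCount_vertOf] at h
  refine h.trans (le_of_eq ?_)
  refine Nat.card_congr ((Equiv.subtypeSubtypeEquivSubtypeInter _ fun q :
    (EdgeCopy n → Bool) × Equiv.Perm (EdgeCopy n) => LoopConnects (vertOf n) q.2 x y).symm.trans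
    ((cycleDecompositionEquiv n).subtypeEquiv fun C => ?_).symm)
  rw [mem_cyclePercolation_iff, or_iff_right hxy]
  rfl

/-! ### Traces -/

theorem trace_adj_vertOf (x : EdgeCopy n) :
    (trace n).Adj (vertOf n (x, true)) (vertOf n (x, false)) := by
  rw [show false = !true from rfl, vertOf_not, trace, SimpleGraph.fromEdgeSet_adj]
  have he : s(vertOf n (x, true), (dartOf (x, true)).snd) = (x.1 : Sym2 V) := dartOf_edge (x, true)
  refine ⟨⟨by rw [he]; exact x.1.2, ?_⟩, (dartOf (x, true)).fst_ne_snd⟩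
  have : (⟨s(vertOf n (x, true), (dartOf (x, true)).snd), by rw [he]; exact x.1.2⟩ : G.edgeSet) =
      x.1 := Subtype.ext he
  rw [this]
  exact x.2.pos

/-- The ends of an edge copy are adjacent in the trace, and consecutive copies of a loop share a
vertex. -/
theorem trace_reachable_of_mem {x y : V} (C : CycleDecomposition n)
    (h : (⟨n, C⟩ : Σ n : G.edgeSet → ℕ, CycleDecomposition n) ∈ cyclePercolation x y) :
    (trace n).Reachable x y := by
  rw [mem_cyclePercolation_iff] at h
  rcases h with rfl | ⟨⟨a, c⟩, ⟨b, d⟩, rfl, rfl, hab⟩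
  · exact SimpleGraph.Reachable.refl _
  have hends : ∀ (x : EdgeCopy n) (c d : Bool),
      (trace n).Reachable (vertOf n (x, c)) (vertOf n (x, d)) := by
    intro x c d
    have := (trace_adj_vertOf x).reachable
    cases c <;> cases d
    · exact SimpleGraph.Reachable.refl _
    · exact this.symm
    · exact this
    · exact SimpleGraph.Reachable.refl _
  have hstep : ∀ x : EdgeCopy n,
      (trace n).Reachable (vertOf n (x, true)) (vertOf n (C.next x, true)) := by
    intro x
    have h1 := (cycleDecompositionEquiv n C).2 x
    refine (hends x true (!(cycleDecompositionEquiv n C).1.1 x)).trans ?_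
    change (trace n).Reachable (head (vertOf n) (cycleDecompositionEquiv n C).1.1 x) _
    rw [← h1]
    exact hends (C.next x) _ _
  obtain ⟨k, rfl⟩ := hab.exists_nat_pow_eq
  refine ((hends a c true).trans ?_).trans (hends _ true d)
  induction k with
  | zero => exact SimpleGraph.Reachable.refl _
  | succ k ih =>
    rw [pow_succ', Equiv.Perm.mul_apply]
    exact (ih ⟨k, rfl⟩).trans (hstep _)

end EdgeCopies

end XYIsing

namespace XYIsing

section Analysis

open scoped Nat

/-! ### Multivariate exponential series -/

theorem hasSum_mul_of_complete {α β : Type*} {f : α → ℂ} {g : β → ℂ} {s t : ℂ}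
    (hf : HasSum f s) (hg : HasSum g t) : HasSum (fun q : α × β => f q.1 * g q.2) (s * t) :=
  hf.mul hg (summable_mul_of_summable_norm hf.summable.norm hg.summable.norm)

theorem hasSum_prod_pow_div_factorial {ι : Type*} [Fintype ι] :
    ∀ x : ι → ℂ, HasSum (fun k : ι → ℕ => ∏ a, x a ^ k a / (k a)!) (Complex.exp (∑ a, x a)) := by
  refine Fintype.induction_empty_option (P := fun ι _ => ∀ x : ι → ℂ,
    HasSum (fun k : ι → ℕ => ∏ a, x a ^ k a / (k a)!) (Complex.exp (∑ a, x a))) ?_ ?_ ?_ ι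
  · intro α β _ e ih x
    let := Fintype.ofEquiv β e.symm
    have h := ih (x ∘ e)
    rw [← (Equiv.arrowCongr e (Equiv.refl ℕ)).hasSum_iff]
    convert! h using 1
    · funext k
      simp only [Function.comp]
      rw [← Equiv.prod_comp e]
      simp
    · rw [← Equiv.sum_comp e]
      simp
  · intro x
    simp [hasSum_unique]
  · intro α _ ih x
    have h1 : HasSum (fun k : ℕ => x none ^ k / (k ! : ℂ)) (Complex.exp (x none)) := by
      rw [Complex.exp_eq_exp_ℂ]
      exact NormedSpace.expSeries_div_hasSum_exp (x none)
    have h2 := ih fun a => x (some a)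
    have h3 := hasSum_mul_of_complete h1 h2
    rw [← (Equiv.piOptionEquivProd (β := fun _ : Option α => ℕ)).symm.hasSum_iff]
    rw [Fintype.sum_option, Complex.exp_add]
    convert! h3 using 1
    funext k
    simp only [Function.comp, Fintype.prod_option, Equiv.piOptionEquivProd, Equiv.coe_fn_symm_mk]

/-- Integration of the exponential series term by term. -/
theorem hasSum_integral_mul_prod_pow {Ω ι : Type*} [MeasurableSpace Ω] [Fintype ι]
    (μ : Measure Ω) [IsFiniteMeasure μ] (g : Ω → ℂ) (u : ι → Ω → ℂ) (hg : Measurable g)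
    (hu : ∀ a, Measurable (u a)) (hg1 : ∀ ω, ‖g ω‖ ≤ 1) (M : ι → ℝ) (hM : ∀ a ω, ‖u a ω‖ ≤ M a) :
    HasSum (fun k : ι → ℕ => ∫ ω, g ω * ∏ a, u a ω ^ k a / (k a)! ∂μ)
      (∫ ω, g ω * Complex.exp (∑ a, u a ω) ∂μ) := by
  have hmeas : ∀ k : ι → ℕ, Measurable fun ω => g ω * ∏ a, u a ω ^ k a / ((k a)! : ℂ) :=
    fun k => hg.mul (Finset.measurable_prod _ fun a _ => ((hu a).pow_const _).div_const _)
  have hbound : ∀ (k : ι → ℕ) ω, ‖g ω * ∏ a, u a ω ^ k a / ((k a)! : ℂ)‖ ≤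
      ∏ a, M a ^ k a / ((k a)! : ℝ) := by
    intro k ω
    rw [norm_mul, norm_prod]
    refine (mul_le_of_le_one_left (Finset.prod_nonneg fun _ _ => norm_nonneg _) (hg1 ω)).trans ?_
    refine Finset.prod_le_prod (fun _ _ => norm_nonneg _) fun a _ => ?_
    rw [norm_div, norm_pow, Complex.norm_natCast]
    gcongr
    exact hM a ω
  have hint : ∀ k : ι → ℕ, Integrable (fun ω => g ω * ∏ a, u a ω ^ k a / ((k a)! : ℂ)) μ :=
    fun k => Integrable.of_bound (hmeas k).aestronglyMeasurable _
      (Filter.Eventually.of_forall (hbound k))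
  -- The dominating series is the exponential series at `M`, which justifies exchanging sum and
  -- integral.
  have hsumM : Summable fun k : ι → ℕ => ∏ a, M a ^ k a / ((k a)! : ℝ) := by
    have h := (hasSum_prod_pow_div_factorial fun a => (M a : ℂ)).summable
    rw [← Complex.summable_ofReal]
    refine h.congr fun k => ?_
    push_cast
    rfl
  have hsum : Summable fun k : ι → ℕ => ∫ ω, ‖g ω * ∏ a, u a ω ^ k a / ((k a)! : ℂ)‖ ∂μ := by
    refine Summable.of_nonneg_of_le (fun k => integral_nonneg fun _ => norm_nonneg _)
      (fun k => ?_) (hsumM.mul_left (μ.real Set.univ))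
    have := integral_mono (hint k).norm (integrable_const _) (hbound k)
    rwa [integral_const, smul_eq_mul] at this
  have h := hasSum_integral_of_summable_integral_norm hint hsum
  have hexp : ∀ ω, ∑' k : ι → ℕ, g ω * ∏ a, u a ω ^ k a / ((k a)! : ℂ) =
      g ω * Complex.exp (∑ a, u a ω) := fun ω => by
    rw [tsum_mul_left, (hasSum_prod_pow_div_factorial fun a => u a ω).tsum_eq]
  simp_rw [hexp] at h
  exact h

/-! ### Fourier coefficients -/

theorem integral_exp_int_mul (m : ℤ) :
    ∫ x in Set.Ioc (-Real.pi) Real.pi, Complex.exp ((m * x : ℝ) * Complex.I) =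
      if m = 0 then (2 * Real.pi : ℂ) else 0 := by
  rw [← intervalIntegral.integral_of_le (by linarith [Real.pi_pos])]
  split_ifs with h
  · subst h
    simp
    ring
  · have hc : (m : ℂ) * Complex.I ≠ 0 := mul_ne_zero (by exact_mod_cast h) Complex.I_ne_zero
    have h1 : ∀ x : ℝ, Complex.exp ((m * x : ℝ) * Complex.I) =
        Complex.exp ((m : ℂ) * Complex.I * x) := fun x => by
      congr 1; push_cast; ring
    simp_rw [h1]
    rw [integral_exp_mul_complex hc, div_eq_zero_iff]
    left
    rw [sub_eq_zero, Complex.exp_eq_exp_iff_exists_int]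
    exact ⟨m, by push_cast; ring⟩

variable {V : Type*} [Fintype V]

/-- The character of the torus with frequencies `m`. -/
noncomputable def character (m : V → ℤ) (θ : V → ℝ) : ℂ :=
  Complex.exp ((∑ v, m v * θ v : ℝ) * Complex.I)

theorem character_add (m m' : V → ℤ) (θ : V → ℝ) :
    character (fun v => m v + m' v) θ = character m θ * character m' θ := by
  rw [character, character, character, ← Complex.exp_add, ← add_mul, ← Complex.ofReal_add,
    ← Finset.sum_add_distrib]
  simp only [Int.cast_add, add_mul]

theorem character_sum {ι : Type*} (s : Finset ι) (m : ι → V → ℤ) (θ : V → ℝ) :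
    character (fun v => ∑ x ∈ s, m x v) θ = ∏ x ∈ s, character (m x) θ := by
  simp only [character]
  rw [← Complex.exp_sum, ← Finset.sum_mul, ← Complex.ofReal_sum]
  congr 3
  rw [Finset.sum_comm]
  exact Finset.sum_congr rfl fun v _ => by push_cast; rw [Finset.sum_mul]

theorem norm_character (m : V → ℤ) (θ : V → ℝ) : ‖character m θ‖ = 1 :=
  Complex.norm_exp_ofReal_mul_I _

theorem continuous_character (m : V → ℤ) : Continuous (character m) := by
  unfold character
  fun_prop

instance : IsFiniteMeasure (angleMeasure V) := by
  unfold angleMeasure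
  infer_instance

theorem integral_character (m : V → ℤ) :
    ∫ θ, character m θ ∂(angleMeasure V) =
      if ∀ v, m v = 0 then (2 * Real.pi : ℂ) ^ Fintype.card V else 0 := by
  have h1 : ∀ θ : V → ℝ, character m θ = ∏ v, Complex.exp ((m v * θ v : ℝ) * Complex.I) := by
    intro θ
    rw [character, ← Complex.exp_sum, Complex.ofReal_sum, Finset.sum_mul]
  simp_rw [h1]
  rw [angleMeasure, integral_fintype_prod_eq_prod
    (fun v (x : ℝ) => Complex.exp ((m v * x : ℝ) * Complex.I))]
  simp_rw [integral_exp_int_mul]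
  split_ifs with h
  · simp [h]
  · push Not at h
    obtain ⟨v, hv⟩ := h
    exact Finset.prod_eq_zero (Finset.mem_univ v) (if_neg hv)

end Analysis

end XYIsing

namespace XYIsing

set_option linter.unusedSectionVars false

section Expansion

open scoped Nat

variable {V : Type*} [Fintype V] [DecidableEq V] {G : SimpleGraph V} [DecidableRel G.Adj]

/-! ### Spins which are constant on clusters -/

/-- The Ising spins do not change along the edges of the trace. -/
def IsClusterwise (n : G.edgeSet → ℕ) (τ : V → ℤˣ) : Prop :=
  ∀ i j, (trace n).Adj i j → τ i = τ j

theorem isClusterwise_iff_dart {n : G.edgeSet → ℕ} {τ : V → ℤˣ} :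
    IsClusterwise n τ ↔ ∀ a : G.Dart, 0 < n ⟨a.edge, a.edge_mem⟩ → τ a.fst = τ a.snd := by
  constructor
  · intro h a ha
    refine h _ _ ?_
    rw [trace, SimpleGraph.fromEdgeSet_adj]
    exact ⟨⟨a.edge_mem, ha⟩, a.fst_ne_snd⟩
  · intro h i j hij
    rw [trace, SimpleGraph.fromEdgeSet_adj] at hij
    obtain ⟨⟨he, hn⟩, _⟩ := hij
    exact h ⟨(i, j), he⟩ hn

theorem isClusterwise_iff_vertOf {n : G.edgeSet → ℕ} {τ : V → ℤˣ} :
    IsClusterwise n τ ↔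
      ∀ x : EdgeCopy n, τ (refDart x.1).fst = τ (refDart x.1).snd := by
  rw [isClusterwise_iff_dart]
  constructor
  · rintro h ⟨e, i⟩
    refine h (refDart e) ?_
    have : (⟨(refDart e).edge, (refDart e).edge_mem⟩ : G.edgeSet) = e :=
      Subtype.ext (refDart_edge e)
    rw [this]
    exact i.pos
  · intro h a ha
    have h1 := h ⟨⟨a.edge, a.edge_mem⟩, ⟨0, ha⟩⟩
    rcases (dart_edge_eq_iff a ⟨a.edge, a.edge_mem⟩).1 rfl with h2 | h2
    · rw [h2]; exact h1
    · rw [h2]; exact h1.symm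

open scoped Classical in
/-- The sum of an observable over the spins which are constant on clusters. -/
noncomputable def spinSum (f : (V → ℤˣ) → ℝ) (n : G.edgeSet → ℕ) : ℝ :=
  ∑ τ, if IsClusterwise n τ then f τ else 0

/-- Spins which are constant on clusters are spins of the clusters. -/
noncomputable def clusterSpinEquiv (n : G.edgeSet → ℕ) :
    ((trace n).ConnectedComponent → ℤˣ) ≃ {τ : V → ℤˣ // IsClusterwise n τ} where
  toFun g := ⟨fun v => g ((trace n).connectedComponentMk v), fun i j h => by
    exact congrArg g (SimpleGraph.ConnectedComponent.eq.2 h.reachable)⟩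
  invFun τ := SimpleGraph.ConnectedComponent.lift τ.1 fun v w p hp => by
    clear hp
    induction p with
    | nil => rfl
    | cons h _ ih => exact (τ.2 _ _ h).trans ih
  left_inv g := by
    funext c
    induction c using SimpleGraph.ConnectedComponent.ind with
    | _ v => rfl
  right_inv τ := rfl

open scoped Classical in
theorem spinSum_eq_sum (f : (V → ℤˣ) → ℝ) (n : G.edgeSet → ℕ) :
    spinSum f n = ∑ g : (trace n).ConnectedComponent → ℤˣ,
      f fun v => g ((trace n).connectedComponentMk v) := by
  rw [spinSum, ← Finset.sum_filter,
    Finset.sum_subtype (p := IsClusterwise n) _ (fun τ => by simp) f]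
  exact (Equiv.sum_comp (clusterSpinEquiv n) fun τ => f τ.1).symm

theorem spinSum_one (n : G.edgeSet → ℕ) : spinSum (fun _ => 1) n = 2 ^ clusterCount n := by
  classical
  rw [spinSum_eq_sum]
  simp [clusterCount, Nat.card_eq_fintype_card]

open scoped Classical in
theorem spinSum_pair (n : G.edgeSet → ℕ) (x y : V) :
    spinSum (fun τ => ((τ x : ℤ) : ℝ) * ((τ y : ℤ) : ℝ)) n =
      if (trace n).Reachable x y then 2 ^ clusterCount n else 0 := by
  rw [spinSum_eq_sum]
  split_ifs with h
  · simp only [SimpleGraph.ConnectedComponent.eq.2 h]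
    have : ∀ u : ℤˣ, ((u : ℤ) : ℝ) * ((u : ℤ) : ℝ) = 1 := fun u => by
      rcases Int.units_eq_one_or u with rfl | rfl <;> simp
    simp [this, clusterCount, Nat.card_eq_fintype_card]
  · have hne : (trace n).connectedComponentMk x ≠ (trace n).connectedComponentMk y := fun he =>
      h (SimpleGraph.ConnectedComponent.eq.1 he)
    -- Flipping the cluster of `x` leaves the spin at `y` alone, so the terms cancel in pairs.
    refine Finset.sum_involution (fun g _ => Function.update g ((trace n).connectedComponentMk x)
      (-g ((trace n).connectedComponentMk x))) ?_ ?_ ?_ ?_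
    · intro g _
      simp [Function.update_of_ne hne.symm]
    · intro g _ _ heq
      have := congrFun heq ((trace n).connectedComponentMk x)
      simp at this
    · simp
    · intro g _
      simp

/-! ### Expansion of the Boltzmann weight -/

/-- The frequencies of the character which is carried by a directed edge. -/
def dartFreq (a : G.Dart) (v : V) : ℤ := (if a.fst = v then 1 else 0) - if a.snd = v then 1 else 0

theorem excess_vertOf (n : G.edgeSet → ℕ) (σ : EdgeCopy n → Bool) (v : V) :
    excess (vertOf n) σ v = ∑ x, dartFreq (dartOf (x, σ x)) v := by
  refine Finset.sum_congr rfl fun x _ => ?_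
  rw [tail, head, vertOf_not, vertOf, dartFreq]
  congr

theorem flow_eq_sum (d : G.Dart → ℕ) (v : V) : flow d v = ∑ a, d a * dartFreq a v := by
  rw [flow, ← Finset.sum_sub_distrib]
  refine Finset.sum_congr rfl fun a _ => ?_
  rw [dartFreq]
  split_ifs <;> simp

theorem sum_dartFreq_mul (a : G.Dart) (θ : V → ℝ) :
    ∑ v, (dartFreq a v : ℝ) * θ v = θ a.fst - θ a.snd := by
  simp [dartFreq, sub_mul, Finset.sum_sub_distrib]

theorem character_dartFreq (a : G.Dart) (θ : V → ℝ) :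
    character (dartFreq a) θ = Complex.exp ((θ a.fst - θ a.snd : ℝ) * Complex.I) := by
  rw [character, sum_dartFreq_mul]

/-- The factor `1 + τ_i τ_j` is 2 or 0, and `2 cos` is the sum of two characters, one for each
direction of the edge. -/
theorem coupling_edge (τ : V → ℤˣ) (θ : V → ℝ) (a : G.Dart) :
    (coupling τ θ a.edge : ℂ) = if τ a.fst = τ a.snd then
      character (dartFreq a) θ + character (dartFreq a.symm) θ else 0 := by
  have h : coupling τ θ a.edge =
    (1 + ((τ a.fst : ℤ) : ℝ) * ((τ a.snd : ℤ) : ℝ)) * Real.cos (θ a.fst - θ a.snd) := rfl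
  rw [h, character_dartFreq, character_dartFreq]
  change _ = if τ a.fst = τ a.snd then
    Complex.exp ((θ a.fst - θ a.snd : ℝ) * Complex.I) +
      Complex.exp ((θ a.snd - θ a.fst : ℝ) * Complex.I) else 0
  have h2 : Complex.exp ((θ a.fst - θ a.snd : ℝ) * Complex.I) +
      Complex.exp ((θ a.snd - θ a.fst : ℝ) * Complex.I) =
      2 * (Real.cos (θ a.fst - θ a.snd) : ℂ) := by
    rw [Complex.ofReal_cos, Complex.two_cos, ← neg_sub (θ a.fst), Complex.ofReal_neg]
  rw [h2]
  rcases Int.units_eq_one_or (τ a.fst) with h1 | h1 <;>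
    rcases Int.units_eq_one_or (τ a.snd) with h3 | h3 <;> rw [h1, h3]
  · norm_num
  · norm_num
  · norm_num
  · norm_num

theorem coupling_edgeCopy {n : G.edgeSet → ℕ} (τ : V → ℤˣ) (θ : V → ℝ) (x : EdgeCopy n) :
    (coupling τ θ x.1 : ℂ) = if τ (refDart x.1).fst = τ (refDart x.1).snd then
      ∑ c, character (dartFreq (dartOf (x, c))) θ else 0 := by
  rw [← refDart_edge x.1, coupling_edge]
  simp [dartOf]

open scoped Classical in
-- Multiplying out the two-term sums chooses a direction for every edge copy, and the frequencies
-- add up to the excess of this orientation.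
theorem prod_coupling_pow (n : G.edgeSet → ℕ) (τ : V → ℤˣ) (θ : V → ℝ) :
    ∏ e : G.edgeSet, (coupling τ θ e : ℂ) ^ n e = if IsClusterwise n τ then
      ∑ σ : EdgeCopy n → Bool, character (excess (vertOf n) σ) θ else 0 := by
  have h1 : ∏ e : G.edgeSet, (coupling τ θ e : ℂ) ^ n e =
      ∏ x : EdgeCopy n, (coupling τ θ x.1 : ℂ) := by
    rw [Fintype.prod_sigma]
    simp
  rw [h1]
  simp_rw [coupling_edgeCopy]
  split_ifs with h
  · rw [isClusterwise_iff_vertOf] at h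
    simp_rw [if_pos (h _)]
    rw [Fintype.prod_sum]
    refine Finset.sum_congr rfl fun σ _ => ?_
    rw [← character_sum]
    congr 1
    funext v
    exact (excess_vertOf n σ v).symm
  · rw [isClusterwise_iff_vertOf] at h
    push Not at h
    obtain ⟨x, hx⟩ := h
    exact Finset.prod_eq_zero (Finset.mem_univ x) (if_neg hx)

open scoped Classical in
theorem integral_character_mul_prod_coupling (n : G.edgeSet → ℕ) (τ : V → ℤˣ) (m : V → ℤ) :
    ∫ θ, character m θ * ∏ e : G.edgeSet, (coupling τ θ e : ℂ) ^ n e ∂(angleMeasure V) =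
      if IsClusterwise n τ then
        (2 * Real.pi : ℂ) ^ Fintype.card V * orientationCount n (-m) else 0 := by
  simp_rw [prod_coupling_pow]
  split_ifs with h
  · simp_rw [Finset.mul_sum, ← character_add]
    rw [integral_finsetSum _ fun σ _ => Integrable.of_bound
      (continuous_character _).aestronglyMeasurable 1
      (Filter.Eventually.of_forall fun θ => (norm_character _ θ).le)]
    simp_rw [integral_character]
    rw [orientationCount, card_filter_eq, Nat.cast_sum, Finset.mul_sum]
    refine Finset.sum_congr rfl fun σ _ => ?_
    -- Only total frequency zero survives the integration, so the excess is `-m`.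
    have : (∀ v, m v + excess (vertOf n) σ v = 0) ↔ ∀ v, excess (vertOf n) σ v = (-m) v :=
      forall_congr' fun v => by rw [Pi.neg_apply, eq_neg_iff_add_eq_zero, add_comm]
    simp only [this]
    split_ifs <;> simp
  · simp

/-- The weight of an undirected current without the number of clusters. -/
noncomputable def edgeWeight (κ : G.edgeSet → ℝ) (β : ℝ) (n : G.edgeSet → ℕ) : ℝ :=
  (∏ e, (β * κ e) ^ n e) / ∏ e, ((n e)! : ℝ)

theorem continuous_coupling (τ : V → ℤˣ) (e : Sym2 V) : Continuous fun θ => coupling τ θ e := by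
  induction e using Sym2.ind with
  | _ i j =>
    change Continuous fun θ : V → ℝ =>
      (1 + ((τ i : ℤ) : ℝ) * ((τ j : ℤ) : ℝ)) * Real.cos (θ i - θ j)
    fun_prop

theorem abs_coupling_le (τ : V → ℤˣ) (θ : V → ℝ) (e : Sym2 V) : |coupling τ θ e| ≤ 2 := by
  induction e using Sym2.ind with
  | _ i j =>
    change |(1 + ((τ i : ℤ) : ℝ) * ((τ j : ℤ) : ℝ)) * Real.cos (θ i - θ j)| ≤ 2
    rw [abs_mul]
    have h1 : |1 + ((τ i : ℤ) : ℝ) * ((τ j : ℤ) : ℝ)| ≤ 2 := by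
      rcases Int.units_eq_one_or (τ i) with h1 | h1 <;>
        rcases Int.units_eq_one_or (τ j) with h3 | h3 <;> rw [h1, h3] <;> norm_num
    calc _ ≤ 2 * 1 := mul_le_mul h1 (Real.abs_cos_le_one _) (abs_nonneg _) (by norm_num)
      _ = 2 := by norm_num

theorem exp_neg_energy (κ : G.edgeSet → ℝ) (β : ℝ) (τ : V → ℤˣ) (θ : V → ℝ) :
    (Real.exp (-β * energy G κ τ θ) : ℂ) =
      Complex.exp (∑ e : G.edgeSet, ((β * κ e : ℝ) : ℂ) * (coupling τ θ e : ℂ)) := by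
  rw [Complex.ofReal_exp, energy, neg_mul_neg, Finset.mul_sum, Complex.ofReal_sum]
  congr 1
  exact Finset.sum_congr rfl fun e _ => by push_cast; ring

theorem continuous_exp_neg_energy (κ : G.edgeSet → ℝ) (β : ℝ) (τ : V → ℤˣ) :
    Continuous fun θ => Real.exp (-β * energy G κ τ θ) := by
  unfold energy
  have := fun e : G.edgeSet => continuous_coupling τ (e : Sym2 V)
  fun_prop

theorem integrable_character_mul_exp (κ : G.edgeSet → ℝ) (β : ℝ) (τ : V → ℤˣ) (m : V → ℤ) :
    Integrable (fun θ => character m θ * (Real.exp (-β * energy G κ τ θ) : ℂ))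
      (angleMeasure V) := by
  refine Integrable.of_bound (C := Real.exp (∑ e : G.edgeSet, |β * κ e| * 2)) ?_
    (Filter.Eventually.of_forall fun θ => ?_)
  · exact ((continuous_character m).mul
      (Complex.continuous_ofReal.comp (continuous_exp_neg_energy κ β τ))).aestronglyMeasurable
  · rw [norm_mul, norm_character, one_mul, Complex.norm_real, Real.norm_eq_abs, Real.abs_exp,
      Real.exp_le_exp, energy, neg_mul_neg, Finset.mul_sum]
    refine Finset.sum_le_sum fun e _ => ?_
    rw [← mul_assoc]
    refine (le_abs_self _).trans ?_
    rw [abs_mul]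
    exact mul_le_mul_of_nonneg_left (abs_coupling_le τ θ e) (abs_nonneg _)

theorem re_integral_character_mul_exp (κ : G.edgeSet → ℝ) (β : ℝ) (τ : V → ℤˣ) (m : V → ℤ) :
    (∫ θ, character m θ * (Real.exp (-β * energy G κ τ θ) : ℂ) ∂(angleMeasure V)).re =
      ∫ θ, Real.cos (∑ v, m v * θ v) * Real.exp (-β * energy G κ τ θ) ∂(angleMeasure V) := by
  have h := integral_re (𝕜 := ℂ) (integrable_character_mul_exp κ β τ m)
  refine h.symm.trans (integral_congr_ae (Filter.Eventually.of_forall fun θ => ?_))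
  simp only [RCLike.re_eq_complex_re, Complex.re_mul_ofReal, character,
    Complex.exp_ofReal_mul_I_re]

open scoped Classical in
/-- The expansion of the model in undirected currents. -/
theorem hasSum_edge_expansion (κ : G.edgeSet → ℝ) (β : ℝ) (f : (V → ℤˣ) → ℝ) (m : V → ℤ) :
    HasSum (fun n : G.edgeSet → ℕ => (2 * Real.pi) ^ Fintype.card V *
        (edgeWeight κ β n * orientationCount n (-m) * spinSum f n))
      (∑ τ, f τ * ∫ θ, Real.cos (∑ v, m v * θ v) *
        Real.exp (-β * energy G κ τ θ) ∂(angleMeasure V)) := by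
  have key : ∀ τ : V → ℤˣ, HasSum (fun n : G.edgeSet → ℕ => if IsClusterwise n τ then
      (2 * Real.pi) ^ Fintype.card V * (edgeWeight κ β n * orientationCount n (-m)) else 0)
      (∫ θ, Real.cos (∑ v, m v * θ v) *
        Real.exp (-β * energy G κ τ θ) ∂(angleMeasure V)) := by
    intro τ
    have h := hasSum_integral_mul_prod_pow (angleMeasure V) (character m)
      (fun (e : G.edgeSet) θ => ((β * κ e : ℝ) : ℂ) * (coupling τ θ e : ℂ))
      (continuous_character m).measurable
      (fun e => (continuous_const.mul (Complex.continuous_ofReal.comp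
        (continuous_coupling τ (e : Sym2 V)))).measurable)
      (fun θ => (norm_character m θ).le) (fun e => |β * κ e| * 2) (fun e θ => by
        rw [norm_mul, Complex.norm_real, Complex.norm_real, Real.norm_eq_abs, Real.norm_eq_abs]
        exact mul_le_mul_of_nonneg_left (abs_coupling_le τ θ e) (abs_nonneg _))
    simp_rw [← exp_neg_energy] at h
    have h2 := Complex.hasSum_re h
    rw [re_integral_character_mul_exp] at h2
    convert h2 using 1
    funext n
    have h3 : ∀ θ : V → ℝ, character m θ * ∏ e : G.edgeSet,
        (((β * κ e : ℝ) : ℂ) * (coupling τ θ e : ℂ)) ^ n e / ((n e)! : ℂ) =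
        (edgeWeight κ β n : ℂ) *
          (character m θ * ∏ e : G.edgeSet, (coupling τ θ e : ℂ) ^ n e) := by
      intro θ
      simp_rw [mul_pow, edgeWeight]
      rw [Finset.prod_div_distrib, Finset.prod_mul_distrib]
      push_cast
      ring
    simp_rw [h3]
    rw [integral_const_mul, integral_character_mul_prod_coupling]
    split_ifs with hc
    · have : (edgeWeight κ β n : ℂ) *
          ((2 * Real.pi : ℂ) ^ Fintype.card V * (orientationCount n (-m) : ℂ)) =
          (((2 * Real.pi) ^ Fintype.card V *
            (edgeWeight κ β n * orientationCount n (-m)) : ℝ) : ℂ) := by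
        push_cast
        ring
      rw [this, Complex.ofReal_re]
    · simp
  have hterm : (fun n : G.edgeSet → ℕ => (2 * Real.pi) ^ Fintype.card V *
      (edgeWeight κ β n * orientationCount n (-m) * spinSum f n)) =
      fun n : G.edgeSet → ℕ => ∑ τ, f τ * if IsClusterwise n τ then
        (2 * Real.pi) ^ Fintype.card V * (edgeWeight κ β n * orientationCount n (-m)) else 0 := by
    funext n
    rw [spinSum, Finset.mul_sum, Finset.mul_sum]
    refine Finset.sum_congr rfl fun τ _ => ?_
    split_ifs <;> ring
  rw [hterm]
  exact hasSum_sum fun τ _ => (key τ).mul_left (f τ)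

/-! ### Expansion in directed currents -/

theorem sum_dart_eq_sum_edge {M : Type*} [AddCommMonoid M] (f : G.Dart → M) :
    ∑ a, f a = ∑ e : G.edgeSet, (f (refDart e) + f (refDart e).symm) := by
  rw [← Finset.sum_fiberwise Finset.univ (fun a : G.Dart => (⟨a.edge, a.edge_mem⟩ : G.edgeSet)) f]
  refine Finset.sum_congr rfl fun e _ => ?_
  have : Finset.univ.filter (fun a : G.Dart => (⟨a.edge, a.edge_mem⟩ : G.edgeSet) = e) =
      {refDart e, (refDart e).symm} := by
    ext a
    simp only [Finset.mem_filter, Finset.mem_univ, true_and, Finset.mem_insert,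
      Finset.mem_singleton, ← dart_edge_eq_iff, Subtype.ext_iff]
  rw [this, Finset.sum_pair (SimpleGraph.Dart.symm_ne _).symm]

theorem undirected_eq (d : G.Dart → ℕ) (e : G.edgeSet) :
    undirected d e = d (refDart e) + d (refDart e).symm := by
  rw [undirected, ← Finset.sum_filter]
  have : Finset.univ.filter (fun a : G.Dart => a.edge = e) =
      {refDart e, (refDart e).symm} := by
    ext a
    simp [dart_edge_eq_iff]
  rw [this, Finset.sum_pair (SimpleGraph.Dart.symm_ne _).symm]

theorem prod_dart_eq_prod_edge {M : Type*} [CommMonoid M] (f : G.Dart → M) :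
    ∏ a, f a = ∏ e : G.edgeSet, (f (refDart e) * f (refDart e).symm) :=
  sum_dart_eq_sum_edge (M := Additive M) f

theorem isClusterwise_undirected_iff {d : G.Dart → ℕ} {τ : V → ℤˣ} :
    IsClusterwise (undirected d) τ ↔ ∀ a : G.Dart, d a ≠ 0 → τ a.fst = τ a.snd := by
  rw [isClusterwise_iff_dart]
  constructor
  · intro h a ha
    refine h a ?_
    rw [undirected]
    refine (Nat.pos_of_ne_zero ha).trans_le ?_
    have := Finset.single_le_sum (f := fun b : G.Dart => if b.edge = a.edge then d b else 0)
      (fun _ _ => Nat.zero_le _) (Finset.mem_univ a)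
    simpa using this
  · intro h a ha
    rw [undirected] at ha
    obtain ⟨b, _, hb⟩ := Finset.exists_ne_zero_of_sum_ne_zero ha.ne'
    simp only [ne_eq, ite_eq_right_iff, Classical.not_imp] at hb
    rcases (SimpleGraph.dart_edge_eq_iff b a).1 hb.1 with h1 | h1
    · rw [← h1]; exact h b hb.2
    · have := h b hb.2
      rw [h1] at this
      exact this.symm

open scoped Classical in
theorem integral_prod_character_pow (d : G.Dart → ℕ) (τ : V → ℤˣ) :
    ∫ θ, ∏ a : G.Dart, (if τ a.fst = τ a.snd then character (dartFreq a) θ else 0) ^ d a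
        ∂(angleMeasure V) =
      if IsClusterwise (undirected d) τ ∧ ∀ v, flow d v = 0 then
        (2 * Real.pi : ℂ) ^ Fintype.card V else 0 := by
  by_cases hc : IsClusterwise (undirected d) τ
  · have h1 : ∀ θ : V → ℝ,
        ∏ a : G.Dart, (if τ a.fst = τ a.snd then character (dartFreq a) θ else 0) ^ d a =
        character (flow d) θ := by
      intro θ
      rw [isClusterwise_undirected_iff] at hc
      have h2 : flow d = fun v => ∑ x : (Σ a : G.Dart, Fin (d a)), dartFreq x.1 v := by
        funext v
        rw [flow_eq_sum, Fintype.sum_sigma]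
        simp
      rw [h2, character_sum, Fintype.prod_sigma]
      refine Finset.prod_congr rfl fun a _ => ?_
      -- For `d a = 0` the power is 1 even if the spins differ, so only directed edges which carry
      -- current constrain the spins.
      by_cases ha : d a = 0
      · have : IsEmpty (Fin (d a)) := by rw [ha]; infer_instance
        simp [ha]
      · rw [if_pos (hc a ha)]
        simp
    simp_rw [h1, integral_character]
    simp [hc]
  · rw [if_neg fun h => hc h.1]
    rw [isClusterwise_undirected_iff] at hc
    push Not at hc
    obtain ⟨a, ha, hne⟩ := hc
    have : ∀ θ : V → ℝ,
        ∏ a : G.Dart, (if τ a.fst = τ a.snd then character (dartFreq a) θ else 0) ^ d a = 0 :=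
      fun θ => Finset.prod_eq_zero (Finset.mem_univ a) (by rw [if_neg hne, zero_pow ha])
    simp only [this, integral_zero]

theorem measurable_ite_character (τ : V → ℤˣ) (a : G.Dart) :
    Measurable fun θ => if τ a.fst = τ a.snd then character (dartFreq a) θ else 0 := by
  split_ifs
  · exact (continuous_character _).measurable
  · exact measurable_const

theorem norm_ite_character_le (τ : V → ℤˣ) (a : G.Dart) (θ : V → ℝ) :
    ‖if τ a.fst = τ a.snd then character (dartFreq a) θ else 0‖ ≤ 1 := by
  split_ifs
  · exact (norm_character _ _).le
  · simp

open scoped Classical in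
/-- The expansion of the model in directed currents. -/
theorem hasSum_dart_expansion (κ : G.edgeSet → ℝ) (β : ℝ) (f : (V → ℤˣ) → ℝ) :
    HasSum (fun d : G.Dart → ℕ => (2 * Real.pi) ^ Fintype.card V *
        (if ∀ v, flow d v = 0 then (∏ e : G.edgeSet, (β * κ e) ^ undirected d e) /
          (∏ a : G.Dart, ((d a)! : ℝ)) * spinSum f (undirected d) else 0))
      (∑ τ, f τ * ∫ θ, Real.exp (-β * energy G κ τ θ) ∂(angleMeasure V)) := by
  set c : G.Dart → ℝ := fun a => β * κ ⟨a.edge, a.edge_mem⟩ with hc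
  have hcref : ∀ e : G.edgeSet, c (refDart e) = β * κ e ∧ c (refDart e).symm = β * κ e := by
    intro e
    have h1 : (⟨(refDart e).edge, (refDart e).edge_mem⟩ : G.edgeSet) = e :=
      Subtype.ext (refDart_edge e)
    have h2 : (⟨(refDart e).symm.edge, (refDart e).symm.edge_mem⟩ : G.edgeSet) = e :=
      Subtype.ext ((SimpleGraph.Dart.edge_symm _).trans (refDart_edge e))
    exact ⟨by rw [hc]; simp only [h1], by rw [hc]; simp only [h2]⟩
  have hw : ∀ d : G.Dart → ℕ,
      ∏ a, c a ^ d a = ∏ e : G.edgeSet, (β * κ e) ^ undirected d e := by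
    intro d
    rw [prod_dart_eq_prod_edge]
    refine Finset.prod_congr rfl fun e _ => ?_
    rw [(hcref e).1, (hcref e).2, ← pow_add, undirected_eq]
  have key : ∀ τ : V → ℤˣ, HasSum (fun d : G.Dart → ℕ =>
      if IsClusterwise (undirected d) τ ∧ ∀ v, flow d v = 0 then
      (2 * Real.pi) ^ Fintype.card V * ((∏ e : G.edgeSet, (β * κ e) ^ undirected d e) /
          (∏ a : G.Dart, ((d a)! : ℝ))) else 0)
      (∫ θ, Real.exp (-β * energy G κ τ θ) ∂(angleMeasure V)) := by
    intro τ
    have h := hasSum_integral_mul_prod_pow (angleMeasure V) (fun _ => 1)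
      (fun (a : G.Dart) θ =>
        (c a : ℂ) * if τ a.fst = τ a.snd then character (dartFreq a) θ else 0)
      measurable_const (fun a => measurable_const.mul (measurable_ite_character τ a))
      (fun θ => by simp) (fun a => |c a|) (fun a θ => by
        rw [norm_mul, Complex.norm_real, Real.norm_eq_abs]
        exact mul_le_of_le_one_right (abs_nonneg _) (norm_ite_character_le τ a θ))
    have hE : ∀ θ, Complex.exp (∑ a : G.Dart,
        (c a : ℂ) * if τ a.fst = τ a.snd then character (dartFreq a) θ else 0) =
        (Real.exp (-β * energy G κ τ θ) : ℂ) := by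
      intro θ
      rw [exp_neg_energy, sum_dart_eq_sum_edge]
      congr 1
      refine Finset.sum_congr rfl fun e _ => ?_
      rw [(hcref e).1, (hcref e).2, ← refDart_edge e, coupling_edge, ← mul_add]
      congr 1
      by_cases ht : τ (refDart e).fst = τ (refDart e).snd
      · have ht' : τ (refDart e).symm.fst = τ (refDart e).symm.snd := ht.symm
        rw [if_pos ht, if_pos ht, if_pos ht']
      · have ht' : ¬τ (refDart e).symm.fst = τ (refDart e).symm.snd := fun h => ht h.symm
        rw [if_neg ht, if_neg ht, if_neg ht', add_zero]
    simp_rw [hE, one_mul, integral_complex_ofReal] at h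
    have h2 := Complex.hasSum_re h
    rw [Complex.ofReal_re] at h2
    convert h2 using 1
    funext d
    have h3 : ∀ θ : V → ℝ, ∏ a : G.Dart,
        ((c a : ℂ) * if τ a.fst = τ a.snd then character (dartFreq a) θ else 0) ^ d a /
          ((d a)! : ℂ) =
        (((∏ a, c a ^ d a) / ∏ a, ((d a)! : ℝ) : ℝ) : ℂ) *
          ∏ a : G.Dart, (if τ a.fst = τ a.snd then character (dartFreq a) θ else 0) ^ d a := by
      intro θ
      simp_rw [mul_pow]
      rw [Finset.prod_div_distrib, Finset.prod_mul_distrib]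
      push_cast
      ring
    simp_rw [h3]
    rw [integral_const_mul, integral_prod_character_pow, hw]
    split_ifs with hc
    · rw [mul_comm, ← Complex.ofReal_re (_ * _)]
      congr 1
      push_cast
      ring
    · simp
  have hterm : (fun d : G.Dart → ℕ => (2 * Real.pi) ^ Fintype.card V *
        (if ∀ v, flow d v = 0 then (∏ e : G.edgeSet, (β * κ e) ^ undirected d e) /
          (∏ a : G.Dart, ((d a)! : ℝ)) * spinSum f (undirected d) else 0)) =
      fun d : G.Dart → ℕ => ∑ τ, f τ *
        if IsClusterwise (undirected d) τ ∧ ∀ v, flow d v = 0 then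
        (2 * Real.pi) ^ Fintype.card V * ((∏ e : G.edgeSet, (β * κ e) ^ undirected d e) /
          (∏ a : G.Dart, ((d a)! : ℝ))) else 0 := by
    funext d
    by_cases hd : ∀ v, flow d v = 0
    · rw [if_pos hd, spinSum, Finset.mul_sum, Finset.mul_sum]
      refine Finset.sum_congr rfl fun τ _ => ?_
      by_cases hτ : IsClusterwise (undirected d) τ
      · rw [if_pos hτ, if_pos ⟨hτ, hd⟩]; ring
      · rw [if_neg hτ, if_neg fun h => hτ h.1]; ring
    · simp [hd]
  rw [hterm]
  exact hasSum_sum fun τ _ => (key τ).mul_left (f τ)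

end Expansion

end XYIsing

namespace XYIsing

set_option linter.unusedSectionVars false

/-! ### Comparison of the weights with the thermal averages -/

section Main

open scoped Nat

variable {V : Type*} [Fintype V] [DecidableEq V] {G : SimpleGraph V} [DecidableRel G.Adj]

theorem edgeWeight_nonneg {κ : G.edgeSet → ℝ} (hκ : ∀ e, 0 ≤ κ e) {β : ℝ} (hβ : 0 ≤ β)
    (n : G.edgeSet → ℕ) : 0 ≤ edgeWeight κ β n :=
  div_nonneg (Finset.prod_nonneg fun e _ => pow_nonneg (mul_nonneg hβ (hκ e)) _)
    (Finset.prod_nonneg fun _ _ => Nat.cast_nonneg _)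

theorem cycleWeight_eq (κ : G.edgeSet → ℝ) (β : ℝ) (n : G.edgeSet → ℕ) (C : CycleDecomposition n) :
    cycleWeight κ β ⟨n, C⟩ =
      edgeWeight κ β n * 2 ^ clusterCount n / (∏ v, (currentDegree n v / 2)! : ℕ) := by
  rw [cycleWeight, edgeWeight, Nat.cast_prod]
  ring

theorem cycleWeight_nonneg {κ : G.edgeSet → ℝ} (hκ : ∀ e, 0 ≤ κ e) {β : ℝ} (hβ : 0 ≤ β)
    (C : Σ n : G.edgeSet → ℕ, CycleDecomposition n) : 0 ≤ cycleWeight κ β C := by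
  obtain ⟨n, C⟩ := C
  rw [cycleWeight_eq]
  have := edgeWeight_nonneg hκ hβ n
  positivity

theorem currentWeight_nonneg {κ : G.edgeSet → ℝ} (hκ : ∀ e, 0 ≤ κ e) {β : ℝ} (hβ : 0 ≤ β)
    (d : G.Dart → ℕ) : 0 ≤ currentWeight κ β d := by
  rw [currentWeight]
  refine Set.indicator_nonneg (fun d _ => ?_) d
  have := Finset.prod_nonneg fun (e : G.edgeSet) (_ : e ∈ Finset.univ) =>
    pow_nonneg (mul_nonneg hβ (hκ e)) (undirected d e)
  positivity

theorem tsum_cycleDecomposition_indicator (κ : G.edgeSet → ℝ) (β : ℝ) (n : G.edgeSet → ℕ)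
    (A : Set (Σ n : G.edgeSet → ℕ, CycleDecomposition n)) :
    ∑' C : CycleDecomposition n, A.indicator (cycleWeight κ β) ⟨n, C⟩ =
      edgeWeight κ β n * 2 ^ clusterCount n / (∏ v, (currentDegree n v / 2)! : ℕ) *
        Nat.card {C : CycleDecomposition n // (⟨n, C⟩ : Σ n, CycleDecomposition n) ∈ A} := by
  classical
  have := Fintype.ofFinite (CycleDecomposition n)
  rw [tsum_fintype, card_filter_eq, Nat.cast_sum, Finset.mul_sum]
  refine Finset.sum_congr rfl fun C _ => ?_
  rw [Set.indicator_apply, cycleWeight_eq]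
  split_ifs <;> simp

/-- The number of successor permutations cancels the denominator of the cycle weight and leaves a
term of the partition function. -/
theorem edgeWeight_mul_div_mul (κ : G.edgeSet → ℝ) (β : ℝ) (n : G.edgeSet → ℕ) :
    edgeWeight κ β n * 2 ^ clusterCount n / (∏ v, (currentDegree n v / 2)! : ℕ) *
      (orientationCount n 0 * ∏ v, (currentDegree n v / 2)! : ℕ) =
    edgeWeight κ β n * orientationCount n 0 * 2 ^ clusterCount n := by
  have h : ((∏ v, (currentDegree n v / 2)! : ℕ) : ℝ) ≠ 0 := by
    rw [Nat.cast_ne_zero]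
    exact Finset.prod_ne_zero_iff.2 fun v _ => Nat.factorial_ne_zero _
  rw [Nat.cast_mul]
  field_simp

theorem hasSum_partitionFunction (κ : G.edgeSet → ℝ) (β : ℝ) :
    HasSum (fun n : G.edgeSet → ℕ => (2 * Real.pi) ^ Fintype.card V *
      (edgeWeight κ β n * orientationCount n 0 * 2 ^ clusterCount n))
      (partitionFunction G κ β) := by
  have h := hasSum_edge_expansion κ β (fun _ => 1) (0 : V → ℤ)
  rw [partitionFunction]
  simpa only [spinSum_one, neg_zero, Pi.zero_apply, Int.cast_zero, zero_mul,
    Finset.sum_const_zero, Real.cos_zero, one_mul] using h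

theorem summable_cycleWeight {κ : G.edgeSet → ℝ} (hκ : ∀ e, 0 ≤ κ e) {β : ℝ} (hβ : 0 ≤ β) :
    Summable (cycleWeight κ β) := by
  rw [summable_sigma_of_nonneg (cycleWeight_nonneg hκ hβ)]
  refine ⟨fun n => Summable.of_finite, ?_⟩
  have h := (hasSum_partitionFunction κ β).summable
  rw [summable_mul_left_iff (by positivity)] at h
  refine h.congr fun n => ?_
  have h1 := tsum_cycleDecomposition_indicator κ β n Set.univ
  simp only [Set.indicator_univ, Set.mem_univ] at h1
  rw [h1, Nat.card_congr (Equiv.subtypeUnivEquiv fun _ => trivial), card_cycleDecomposition,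
    edgeWeight_mul_div_mul]

theorem hasSum_indicator_cycleWeight {κ : G.edgeSet → ℝ} (hκ : ∀ e, 0 ≤ κ e) {β : ℝ} (hβ : 0 ≤ β)
    (A : Set (Σ n : G.edgeSet → ℕ, CycleDecomposition n)) :
    HasSum (fun n => edgeWeight κ β n * 2 ^ clusterCount n /
        (∏ v, (currentDegree n v / 2)! : ℕ) *
        Nat.card {C : CycleDecomposition n // (⟨n, C⟩ : Σ n, CycleDecomposition n) ∈ A})
      (∑' C, A.indicator (cycleWeight κ β) C) := by
  have h := ((summable_cycleWeight hκ hβ).indicator A).hasSum.sigma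
    fun n => (Summable.of_finite (f := fun C : CycleDecomposition n =>
      A.indicator (cycleWeight κ β) ⟨n, C⟩)).hasSum
  simpa only [tsum_cycleDecomposition_indicator] using h

theorem partitionFunction_eq_tsum_cycleWeight {κ : G.edgeSet → ℝ} (hκ : ∀ e, 0 ≤ κ e) {β : ℝ}
    (hβ : 0 ≤ β) :
    partitionFunction G κ β = (2 * Real.pi) ^ Fintype.card V * ∑' C, cycleWeight κ β C := by
  have h := (hasSum_indicator_cycleWeight hκ hβ Set.univ).mul_left
    ((2 * Real.pi) ^ Fintype.card V)
  rw [Set.indicator_univ] at h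
  refine (hasSum_partitionFunction κ β).unique ?_
  convert! h using 3 with n
  rw [Nat.card_congr (Equiv.subtypeUnivEquiv fun _ => Set.mem_univ _), card_cycleDecomposition,
    edgeWeight_mul_div_mul]

theorem orientationCount_source_mul_le (n : G.edgeSet → ℕ) (x y : V) :
    orientationCount n (-fun v => 2 * ((if v = y then 1 else 0) - if v = x then 1 else 0)) *
        ∏ v, (currentDegree n v / 2)! ≤
      Nat.card {C : CycleDecomposition n //
        (⟨n, C⟩ : Σ n : G.edgeSet → ℕ, CycleDecomposition n) ∈ cyclePercolation x y} := by
  -- For `x = y` the sources cancel and the event is everything, so equality holds.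
  by_cases hxy : x = y
  · subst hxy
    simp only [sub_self, mul_zero]
    change orientationCount n (-0) * _ ≤ _
    rw [neg_zero, ← card_cycleDecomposition]
    exact (Nat.card_congr (Equiv.subtypeUnivEquiv fun C => Or.inl rfl)).ge
  · refine orientationCount_mul_le hxy ?_ fun v hx hy => ?_
    · simp [hxy]
    · simp [hx, hy]

/-- The expectation of `cos 2(θ_x - θ_y)` before normalization. -/
theorem cos_sum_le {κ : G.edgeSet → ℝ} (hκ : ∀ e, 0 ≤ κ e) {β : ℝ} (hβ : 0 ≤ β) (x y : V) :
    ∑ τ : V → ℤˣ, ∫ θ, Real.cos (2 * (θ x - θ y)) * Real.exp (-β * energy G κ τ θ)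
        ∂(angleMeasure V) ≤
      (2 * Real.pi) ^ Fintype.card V *
        ∑' C, (cyclePercolation x y).indicator (cycleWeight κ β) C := by
  -- The frequencies are those of `2(θ y - θ x)`: the cosine is even, and the orientation count
  -- takes `-m`, which for `x ≠ y` has its source 2 at `x`.
  have h := hasSum_edge_expansion κ β (fun _ => 1)
    (fun v : V => 2 * ((if v = y then 1 else 0) - if v = x then 1 else 0))
  have hcos : ∀ θ : V → ℝ, Real.cos (∑ v,
      ((2 * ((if v = y then 1 else 0) - if v = x then 1 else 0) : ℤ) : ℝ) * θ v) =
      Real.cos (2 * (θ x - θ y)) := by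
    intro θ
    rw [← Real.cos_neg]
    congr 1
    push_cast
    simp only [mul_assoc, sub_mul, ite_mul, one_mul, zero_mul]
    rw [← Finset.mul_sum, Finset.sum_sub_distrib]
    simp
    ring
  simp only [hcos, one_mul, spinSum_one] at h
  refine hasSum_le (fun n => ?_) h
    ((hasSum_indicator_cycleWeight hκ hβ (cyclePercolation x y)).mul_left _)
  refine mul_le_mul_of_nonneg_left ?_ (by positivity)
  have h1 := orientationCount_source_mul_le n x y
  rw [← Nat.cast_le (α := ℝ), Nat.cast_mul] at h1
  have hpos : (0 : ℝ) < (∏ v, (currentDegree n v / 2)! : ℕ) := by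
    rw [Nat.cast_pos]
    exact Finset.prod_pos fun v _ => Nat.factorial_pos _
  rw [mul_right_comm, div_mul_eq_mul_div, mul_div_assoc]
  refine mul_le_mul_of_nonneg_left ?_ (mul_nonneg (edgeWeight_nonneg hκ hβ n) (by positivity))
  rwa [le_div_iff₀ hpos]

/-- Termwise in `n`: if `x` and `y` are not connected in the trace, no decomposition lies in the
event; if they are, the right side counts all decompositions. -/
theorem tsum_cyclePercolation_le {κ : G.edgeSet → ℝ} (hκ : ∀ e, 0 ≤ κ e) {β : ℝ} (hβ : 0 ≤ β)
    (x y : V) :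
    (2 * Real.pi) ^ Fintype.card V *
        ∑' C, (cyclePercolation x y).indicator (cycleWeight κ β) C ≤
      ∑ τ : V → ℤˣ, ∫ θ, ((τ x : ℤ) : ℝ) * ((τ y : ℤ) : ℝ) * Real.exp (-β * energy G κ τ θ)
        ∂(angleMeasure V) := by
  classical
  have h := hasSum_edge_expansion κ β
    (fun τ => ((τ x : ℤ) : ℝ) * ((τ y : ℤ) : ℝ)) (0 : V → ℤ)
  simp only [spinSum_pair, neg_zero, Pi.zero_apply, Int.cast_zero, zero_mul,
    Finset.sum_const_zero, Real.cos_zero, one_mul, ← integral_const_mul] at h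
  refine hasSum_le (fun n => ?_)
    ((hasSum_indicator_cycleWeight hκ hβ (cyclePercolation x y)).mul_left _) h
  refine mul_le_mul_of_nonneg_left ?_ (by positivity)
  split_ifs with hr
  · rw [← edgeWeight_mul_div_mul, ← card_cycleDecomposition]
    refine mul_le_mul_of_nonneg_left ?_ ?_
    · exact_mod_cast Nat.card_le_card_of_injective _ Subtype.val_injective
    · have := edgeWeight_nonneg hκ hβ n
      positivity
  · have : IsEmpty {C : CycleDecomposition n //
        (⟨n, C⟩ : Σ n : G.edgeSet → ℕ, CycleDecomposition n) ∈ cyclePercolation x y} :=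
      ⟨fun C => hr (trace_reachable_of_mem C.1 C.2)⟩
    simp

theorem currentWeight_eq_ite (κ : G.edgeSet → ℝ) (β : ℝ) (d : G.Dart → ℕ) :
    currentWeight κ β d = if ∀ v, flow d v = 0 then
      (∏ e : G.edgeSet, (β * κ e) ^ undirected d e) / (∏ a : G.Dart, ((d a)! : ℝ)) *
        2 ^ clusterCount (undirected d) else 0 := by
  classical
  rw [currentWeight, Set.indicator_apply]
  simp only [Set.mem_ofPred_eq]
  congr 1
  ring

theorem hasSum_currentWeight (κ : G.edgeSet → ℝ) (β : ℝ) :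
    HasSum (fun d : G.Dart → ℕ => (2 * Real.pi) ^ Fintype.card V * currentWeight κ β d)
      (partitionFunction G κ β) := by
  have h := hasSum_dart_expansion κ β fun _ => 1
  simp only [spinSum_one, one_mul] at h
  simp only [currentWeight_eq_ite]
  convert! h using 5

theorem hasSum_indicator_currentWeight (κ : G.edgeSet → ℝ) (β : ℝ) (x y : V) :
    HasSum (fun d : G.Dart → ℕ => (2 * Real.pi) ^ Fintype.card V *
        (tracePercolation x y).indicator (currentWeight κ β) d)
      (∑ τ : V → ℤˣ, ∫ θ, ((τ x : ℤ) : ℝ) * ((τ y : ℤ) : ℝ) * Real.exp (-β * energy G κ τ θ)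
        ∂(angleMeasure V)) := by
  classical
  have h := hasSum_dart_expansion κ β fun τ => ((τ x : ℤ) : ℝ) * ((τ y : ℤ) : ℝ)
  simp only [spinSum_pair, ← integral_const_mul] at h
  convert! h using 3 with d
  rw [Set.indicator_apply, currentWeight_eq_ite, tracePercolation, Set.mem_ofPred_eq]
  split_ifs <;> simp

theorem summable_currentWeight (κ : G.edgeSet → ℝ) (β : ℝ) :
    Summable (currentWeight κ β : (G.Dart → ℕ) → ℝ) := by
  have h := (hasSum_currentWeight (G := G) κ β).summable
  rwa [summable_mul_left_iff (by positivity)] at h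

theorem isNormalizable_currentWeight {κ : G.edgeSet → ℝ} (hκ : ∀ e, 0 ≤ κ e) {β : ℝ}
    (hβ : 0 ≤ β) : IsNormalizable (currentWeight κ β : (G.Dart → ℕ) → ℝ) := by
  -- The zero current has positive weight whatever `κ` and `β` are.
  refine ⟨currentWeight_nonneg hκ hβ, summable_currentWeight κ β,
    (summable_currentWeight κ β).tsum_pos (currentWeight_nonneg hκ hβ) 0 ?_⟩
  have hu : undirected (0 : G.Dart → ℕ) = 0 := by
    funext e
    simp [undirected]
  rw [currentWeight_eq_ite, if_pos (fun v => by simp [flow]), hu]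
  simp

theorem partitionFunction_eq_tsum_currentWeight (κ : G.edgeSet → ℝ) (β : ℝ) :
    partitionFunction G κ β =
      (2 * Real.pi) ^ Fintype.card V * ∑' d : G.Dart → ℕ, currentWeight κ β d := by
  rw [← tsum_mul_left, (hasSum_currentWeight κ β).tsum_eq]

/-- Both families of weights have the same sum, the partition function divided by a power of 2π, so
positivity carries over from directed currents. -/
theorem isNormalizable_cycleWeight {κ : G.edgeSet → ℝ} (hκ : ∀ e, 0 ≤ κ e) {β : ℝ}
    (hβ : 0 ≤ β) : IsNormalizable (cycleWeight (G := G) κ β) := by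
  refine ⟨cycleWeight_nonneg hκ hβ, summable_cycleWeight hκ hβ, ?_⟩
  have h1 := partitionFunction_eq_tsum_cycleWeight hκ hβ
  rw [partitionFunction_eq_tsum_currentWeight] at h1
  have h2 := (isNormalizable_currentWeight hκ hβ).2.2
  have hpi : (0 : ℝ) < (2 * Real.pi) ^ Fintype.card V := by positivity
  rwa [← mul_left_cancel₀ hpi.ne' h1]

end Main

end XYIsing

theorem mainTheorem3 {V : Type*} [Fintype V] [DecidableEq V] (G : SimpleGraph V)
    [DecidableRel G.Adj] (κ : G.edgeSet → ℝ) (hκ : ∀ e, 0 ≤ κ e) (β : ℝ) (hβ : 0 ≤ β)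
    (o R : V) :
    XYIsing.thermalAverage G κ β (fun _ θ => Real.cos (2 * (θ o - θ R))) ≤
        XYIsing.thermalAverage G κ β (fun τ _ => ((τ o : ℤ) : ℝ) * ((τ R : ℤ) : ℝ)) ∧
      (XYIsing.IsNormalizable (XYIsing.currentWeight κ β) ∧
        XYIsing.thermalAverage G κ β (fun τ _ => ((τ o : ℤ) : ℝ) * ((τ R : ℤ) : ℝ)) =
          XYIsing.prob (XYIsing.currentWeight κ β) (XYIsing.tracePercolation o R)) ∧
      (XYIsing.IsNormalizable (XYIsing.cycleWeight κ β) ∧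
        XYIsing.thermalAverage G κ β (fun _ θ => Real.cos (2 * (θ o - θ R))) ≤
          XYIsing.prob (XYIsing.cycleWeight κ β) (XYIsing.cyclePercolation o R)) := by
  have hcyc := XYIsing.isNormalizable_cycleWeight hκ hβ
  have hpi : (0 : ℝ) < (2 * Real.pi) ^ Fintype.card V := by positivity
  have hZ := XYIsing.partitionFunction_eq_tsum_cycleWeight hκ hβ
  have hZpos : 0 < XYIsing.partitionFunction G κ β := by
    rw [hZ]
    exact mul_pos hpi hcyc.2.2
  have h1 := XYIsing.cos_sum_le hκ hβ o R
  refine ⟨?_, ⟨XYIsing.isNormalizable_currentWeight hκ hβ, ?_⟩, hcyc, ?_⟩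
  · exact div_le_div_of_nonneg_right (h1.trans (XYIsing.tsum_cyclePercolation_le hκ hβ o R))
      hZpos.le
  · rw [XYIsing.thermalAverage, XYIsing.prob, XYIsing.partitionFunction_eq_tsum_currentWeight,
      ← (XYIsing.hasSum_indicator_currentWeight κ β o R).tsum_eq, tsum_mul_left,
      mul_div_mul_left _ _ hpi.ne']
  · rw [XYIsing.prob, ← mul_div_mul_left _ _ hpi.ne', ← hZ]
    exact div_le_div_of_nonneg_right h1 hZpos.le
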